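/- Conventions. An affine plane curve $\mathcal C\subset\mathbb C^2$ is real if it contains infinitely many points of $\mathbb R^2$. It is $\mathbb K$-definable ($\mathbb K$ a subfield of $\mathbb C$) if it has a defining polynomial with coefficients in $\mathbb K$. It is a Hausdorff curve if the number of its (distinct) points at infinity equals its degree. For a projective curve $\mathcal D=\{F(x,y,z)=0\}\subset\mathbb P^2(\mathbb C)$, $F$ a form, let $\mathcal D_a$ be its affine part $F(x,y,1)=0$; $\mathcal D$ is called real if $\mathcal D_a$ is real. An irreducible curve is monomial if it has a point of multiplicity one less than its degree. A curve $F=0$ is parametrizable over $\mathbb K$ if there are $p_1,p_2,p_3\in\mathbb K[t]$, not all constant and with $\gcd(p_1,p_2,p_3)=1$, such that $F(p_1,p_2,p_3)=0$; it is rational if it is parametrizable over $\mathbb C$. $\mathrm H$ is the Hausdorff distance (with values in $[0,\infty]$) between subsets of the Euclidean plane $\mathbb R^2$. Statement. Let $\mathbb K$ be a subfield of $\mathbb C$ and let $\mathcal C$ be a real irreducible (over $\mathbb C$) affine $\mathbb K$-definable Hausdorff curve of degree $n$, with points at infinity $(a_i:b_i:0)$, $i=1,\dots,n$. (1) There are infinitely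 many real monomial (hence rational) plane curves $\mathcal D$, with pairwise different affine parts, parametrizable over $\mathbb K$, such that $\mathrm H(\mathcal C\cap\mathbb R^2,\mathcal D_a\cap\mathbb R^2)<\infty$. (2) Let $P=(a:b:1)\in\mathbb P^2(\mathbb C)$ be any point with $ab_i-ba_i\neq0$ for $i=1,\dots,n$, and let $\mathcal H$ be the linear system of all projective curves of degree $n$ that pass through every $(a_i:b_i:0)$ and have multiplicity at least $n-1$ at $P$. Then $\mathcal H$ has (projective) dimension exactly $n$. Every irreducible curve in $\mathcal H$ is monomial and rational, and every real irreducible curve $\mathcal D\in\mathcal H$ satisfies $\mathrm H(\mathcal C\cap\mathbb R^2,\mathcal D_a\cap\mathbb R^2)<\infty$; that is, all real irreducible members of $\mathcal H$ solve the approximate parametrization problem for $\mathcal C$. -/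

import Mathlib

open MvPolynomial

noncomputable section

namespace HausdorffCurves

/-- The complex projective plane. -/
abbrev P2 : Type := Projectivization ℂ (Fin 3 → ℂ)

/-- The point `(a : b : 1)`. -/
def affinePoint (a b : ℂ) : P2 :=
  Projectivization.mk ℂ ![a, b, 1] (fun h => one_ne_zero (congrFun h 2))

/-- The polynomial `F(v + X)`. -/
def shift (v : Fin 3 → ℂ) : MvPolynomial (Fin 3) ℂ →ₐ[ℂ] MvPolynomial (Fin 3) ℂ :=
  aeval (fun i => X i + C (v i))

/-- The polynomials having multiplicity at least `s` at `P`: the expansion `F(v + X)` at a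
representative `v` of `P` has no term of degree `< s`.  For homogeneous `F` this does not depend on
the representative. -/
def multAtLeast (P : P2) (s : ℕ) : Submodule ℂ (MvPolynomial (Fin 3) ℂ) where
  carrier := {F | ∀ d : Fin 3 →₀ ℕ, d.degree < s → coeff d (shift P.rep F) = 0}
  zero_mem' := by intro d _; simp
  add_mem' := by
    intro F G hF hG d hd
    simp [hF d hd, hG d hd]
  smul_mem' := by
    intro c F hF d hd
    simp [hF d hd]

/-- The form `F` has multiplicity exactly `s` at `P`. -/
def HasMultiplicity (F : MvPolynomial (Fin 3) ℂ) (P : P2) (s : ℕ) : Prop :=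
  F ∈ multAtLeast P s ∧ F ∉ multAtLeast P (s + 1)

/-- An effective divisor: finitely many points of the projective plane with multiplicities. -/
abbrev EffectiveDivisor : Type := P2 →₀ ℕ

/-- The linear system `H(n, D)` of forms of degree `n` that pass through each point `P` with
multiplicity at least `D P`, as a linear space of forms (its projectivization is the set of
curves). -/
def linearSystem (n : ℕ) (D : EffectiveDivisor) : Submodule ℂ (MvPolynomial (Fin 3) ℂ) :=
  homogeneousSubmodule (Fin 3) ℂ n ⊓ ⨅ P : P2, multAtLeast P (D P)

/-- Dimension, as a projective space, of the projectivization of a linear space of forms. -/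
def projDim (L : Submodule ℂ (MvPolynomial (Fin 3) ℂ)) : ℤ :=
  (Module.finrank ℂ L : ℤ) - 1

/-- The affine part `F(x, y, 1)` of a projective curve. -/
def affinePart (F : MvPolynomial (Fin 3) ℂ) : MvPolynomial (Fin 2) ℂ :=
  aeval ![X 0, X 1, 1] F

/-- The complex affine curve `f = 0`, as a point set. -/
def affineCurve (f : MvPolynomial (Fin 2) ℂ) : Set (Fin 2 → ℂ) :=
  {p | eval p f = 0}

/-- The real points of the affine curve `f = 0`, in the Euclidean plane. -/
def realPoints (f : MvPolynomial (Fin 2) ℂ) : Set (EuclideanSpace ℝ (Fin 2)) :=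
  {p | eval (fun i => (p i : ℂ)) f = 0}

/-- An affine curve is real if it contains infinitely many real points. -/
def IsReal (f : MvPolynomial (Fin 2) ℂ) : Prop := (realPoints f).Infinite

/-- The points at infinity `(u : v : 0)` of the affine curve `f = 0`: the zeros of the leading form
of `f`, equivalently of the homogenization of `f` on the line `z = 0`. -/
def pointsAtInfinity (f : MvPolynomial (Fin 2) ℂ) : Set P2 :=
  {Q | Q.rep 2 = 0 ∧
    eval ![Q.rep 0, Q.rep 1] (homogeneousComponent f.totalDegree f) = 0}

/-- A Hausdorff curve has as many points at infinity as its degree. -/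
def IsHausdorffCurve (f : MvPolynomial (Fin 2) ℂ) : Prop :=
  (pointsAtInfinity f).encard = f.totalDegree

/-- The Hausdorff divisor associated to `f = 0`: the sum of its points at infinity. -/
def hausdorffDivisor (f : MvPolynomial (Fin 2) ℂ) : EffectiveDivisor :=
  ∑ᶠ Q ∈ pointsAtInfinity f, Finsupp.single Q 1

/-- The curve has a defining polynomial with coefficients in `K`. -/
def IsDefinableOver (K : Subfield ℂ) (f : MvPolynomial (Fin 2) ℂ) : Prop :=
  ∃ (g : MvPolynomial (Fin 2) K) (c : ℂ), c ≠ 0 ∧ map (algebraMap K ℂ) g = C c * f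

/-- The projective curve `F = 0` has a rational parametrization `(p₁ : p₂ : p₃)` by polynomials over
`k` that are not all constant and have no common factor. -/
def ParametrizableOver (k : Type) [Field k] [Algebra k ℂ] (F : MvPolynomial (Fin 3) ℂ) : Prop :=
  ∃ p : Fin 3 → Polynomial k,
    (∃ i, 0 < (p i).natDegree) ∧
    (∀ q : Polynomial k, (∀ i, q ∣ p i) → IsUnit q) ∧
    aeval (fun i => (p i).map (algebraMap k ℂ)) F = 0

/-- A rational curve: parametrizable over the complex numbers. -/
def IsRational (F : MvPolynomial (Fin 3) ℂ) : Prop := ParametrizableOver ℂ F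

/-- A monomial curve: an irreducible projective curve of some degree `m + 1` with a point of
multiplicity `m`. -/
def IsMonomialCurve (F : MvPolynomial (Fin 3) ℂ) : Prop :=
  Irreducible F ∧ ∃ m : ℕ, F.IsHomogeneous (m + 1) ∧ ∃ P : P2, HasMultiplicity F P m

/-- The real parts of two affine curves are at finite Hausdorff distance. -/
def FiniteHausdorffDistance (f g : MvPolynomial (Fin 2) ℂ) : Prop :=
  Metric.hausdorffEDist (realPoints f) (realPoints g) < ⊤

/-- The condition `a bᵢ - b aᵢ ≠ 0` at all points at infinity `(aᵢ : bᵢ : 0)` of the curve, for the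
point `(a : b : 1)`. -/
def IsAdmissible (f : MvPolynomial (Fin 2) ℂ) (a b : ℂ) : Prop :=
  ∀ Q ∈ pointsAtInfinity f, a * Q.rep 1 - b * Q.rep 0 ≠ 0

end HausdorffCurves

end

/-! Put `n = m + 1` and let `h` be the leading form of `f`. Having `n` points at infinity means that
`h` has `n` distinct, hence simple, zeros. Expanding a member of the linear system at `P = (a : b :
1)`, its affine part has degree at most `m + 1` and order at least `m`, so only two homogeneous
pieces survive: `F = z A(x - az, y - bz) + B(x - az, y - bz)`. Restriction to the line at infinity
gives `B`, which vanishes at the `n` zeros of `h`, so `B = c h`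
(`mem_linearSystem_iff_exists_coneForm`). The `m + 1` coefficients of `A` together with `c` give
projective dimension `n`. A line through `P` meets such a curve in one residual point, rational in
the slope: this is the parametrization. A common zero of `A` and `B` would split off a line.

The metric statement depends only on leading forms
(`finiteHausdorffDistance_of_homogeneousComponent`). A real irreducible curve shares infinitely many
points with its conjugate, so it has a real equation up to a constant. Suppose points of one real
curve escape from every bounded neighbourhood of another with the same leading form. Their
directions accumulate at a zero of that form. As the zero is simple, the second equation, suitably
rescaled, changes sign on a segment of bounded length through each far point, so the second curve is
met there: a contradiction.

For the infinite family, take `P` to be the origin, `B` a normalization of `h` with coefficients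
both in `K` and in `ℝ`, and `A = c (x - t₀ y) ^ m` with `c`, `t₀` natural numbers and `B(t₀, 1) ≠
0`. Natural numbers lie in every `K`, the last condition gives irreducibility, and distinct `c` give
distinct curves. -/

noncomputable section

namespace HausdorffCurves

/-! ### Homogenization and affine parts -/

section Forms

variable {k : Type*} [Field k]

theorem aeval_mul_of_isHomogeneous {σ R A : Type*} [CommSemiring R] [CommSemiring A] [Algebra R A]
    {F : MvPolynomial σ R} {n : ℕ} (hF : F.IsHomogeneous n) (r : A) (v : σ → A) :
    aeval (fun i => r * v i) F = r ^ n * aeval v F := by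
  rw [aeval_def, aeval_def, eval₂_eq, eval₂_eq, Finset.mul_sum]
  refine Finset.sum_congr rfl fun d hd => ?_
  have h := hF (mem_support_iff.mp hd)
  rw [Finsupp.weight_apply, Finsupp.sum] at h
  simp only [Pi.one_apply, smul_eq_mul, mul_one] at h
  simp only [mul_pow, Finset.prod_mul_distrib, Finset.prod_pow_eq_pow_sum, h]
  ring

theorem eval_mul_of_isHomogeneous {σ R : Type*} [CommSemiring R]
    {F : MvPolynomial σ R} {n : ℕ} (hF : F.IsHomogeneous n) (r : R) (v : σ → R) :
    eval (fun i => r * v i) F = r ^ n * eval v F := by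
  exact aeval_mul_of_isHomogeneous (A := R) hF r v

theorem totalDegree_aeval_le_of_totalDegree_le_one {σ τ R : Type*} [CommSemiring R]
    (F : MvPolynomial σ R) (g : σ → MvPolynomial τ R) (hg : ∀ i, (g i).totalDegree ≤ 1) :
    (aeval g F).totalDegree ≤ F.totalDegree := by
  rw [aeval_def, eval₂_eq]
  refine totalDegree_finsetSum_le fun d hd => ?_
  refine (totalDegree_mul _ _).trans ?_
  rw [algebraMap_eq, totalDegree_C, zero_add]
  refine (totalDegree_finsetProd _ _).trans ?_
  refine le_trans (Finset.sum_le_sum fun i _ => ?_) (le_totalDegree hd)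
  refine (totalDegree_pow _ _).trans ?_
  simpa using Nat.mul_le_mul_left (d i) (hg i)

/-- The form of degree `n` in three variables whose affine part is `p`, if `p` has degree at most
`n`. -/
def homogenization (n : ℕ) (p : MvPolynomial (Fin 2) k) : MvPolynomial (Fin 3) k :=
  ∑ j ∈ Finset.range (n + 1), X 2 ^ (n - j) * rename Fin.castSucc (homogeneousComponent j p)

theorem isHomogeneous_homogenization (n : ℕ) (p : MvPolynomial (Fin 2) k) :
    (homogenization n p).IsHomogeneous n := by
  refine IsHomogeneous.sum _ _ _ fun j hj => ?_
  have hj' : j ≤ n := Nat.lt_succ_iff.mp (Finset.mem_range.mp hj)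
  have h := (isHomogeneous_X_pow (R := k) (2 : Fin 3) (n - j)).mul
    ((homogeneousComponent_isHomogeneous j p).rename_isHomogeneous (f := Fin.castSucc))
  rwa [Nat.sub_add_cancel hj'] at h

theorem aeval_homogenization {A : Type*} [CommRing A] [Algebra k A] (n : ℕ)
    (p : MvPolynomial (Fin 2) k) (v : Fin 3 → A) :
    aeval v (homogenization n p) = ∑ j ∈ Finset.range (n + 1),
      v 2 ^ (n - j) * aeval (fun i : Fin 2 => v i.castSucc) (homogeneousComponent j p) := by
  simp [homogenization, aeval_rename, Function.comp_def]

theorem sum_homogeneousComponent_of_le {n : ℕ} {p : MvPolynomial (Fin 2) k}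
    (hp : p.totalDegree ≤ n) : ∑ j ∈ Finset.range (n + 1), homogeneousComponent j p = p := by
  conv_rhs => rw [← sum_homogeneousComponent p]
  refine (Finset.sum_subset (Finset.range_subset_range.mpr (by omega)) fun j _ hj => ?_).symm
  exact homogeneousComponent_eq_zero _ _ (by simpa using hj)

theorem aeval_homogenization_of_eq_one {A : Type*} [CommRing A] [Algebra k A] {n : ℕ}
    {p : MvPolynomial (Fin 2) k} (hp : p.totalDegree ≤ n) (v : Fin 3 → A) (hv : v 2 = 1) :
    aeval v (homogenization n p) = aeval (fun i : Fin 2 => v i.castSucc) p := by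
  rw [aeval_homogenization, hv]
  conv_rhs => rw [← sum_homogeneousComponent_of_le hp]
  simp

theorem aeval_homogenization_of_eq_zero {A : Type*} [CommRing A] [Algebra k A] (n : ℕ)
    (p : MvPolynomial (Fin 2) k) (v : Fin 3 → A) (hv : v 2 = 0) :
    aeval v (homogenization n p) =
      aeval (fun i : Fin 2 => v i.castSucc) (homogeneousComponent n p) := by
  rw [aeval_homogenization, hv, Finset.sum_range_succ, Finset.sum_eq_zero]
  · simp
  · intro j hj
    rw [zero_pow (by have := Finset.mem_range.mp hj; omega), zero_mul]

theorem affinePart_homogenization {n : ℕ} {p : MvPolynomial (Fin 2) ℂ} (hp : p.totalDegree ≤ n) :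
    affinePart (homogenization n p) = p := by
  rw [affinePart, aeval_homogenization_of_eq_one hp _ (by simp)]
  conv_rhs => rw [← aeval_X_left_apply p]
  congr 2
  funext i
  fin_cases i <;> rfl

theorem eval_affinePart (F : MvPolynomial (Fin 3) ℂ) (p : Fin 2 → ℂ) :
    eval p (affinePart F) = eval ![p 0, p 1, 1] F := by
  show aeval p (aeval _ F) = aeval _ F
  rw [comp_aeval_apply]
  congr 2
  funext i
  fin_cases i <;> simp

theorem totalDegree_affinePart_le {F : MvPolynomial (Fin 3) ℂ} {n : ℕ} (hF : F.IsHomogeneous n) :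
    (affinePart F).totalDegree ≤ n := by
  refine (totalDegree_aeval_le_of_totalDegree_le_one F _ fun i => ?_).trans hF.totalDegree_le
  fin_cases i <;> simp

theorem affinePart_injective_of_isHomogeneous {F G : MvPolynomial (Fin 3) ℂ} {n : ℕ}
    (hF : F.IsHomogeneous n) (hG : G.IsHomogeneous n) (h : affinePart F = affinePart G) :
    F = G := by
  -- The affine part controls `F` only where the last coordinate is nonzero; the factor `X 2` makes
  -- the two sides agree everywhere.
  have key : X 2 * F = X 2 * G := by
    refine MvPolynomial.funext fun v => ?_
    simp only [map_mul, eval_X]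
    by_cases hv : v 2 = 0
    · simp [hv]
    have aux : ∀ {H : MvPolynomial (Fin 3) ℂ}, H.IsHomogeneous n →
        eval v H = v 2 ^ n * eval ![v 0 / v 2, v 1 / v 2] (affinePart H) := by
      intro H hH
      rw [eval_affinePart, ← eval_mul_of_isHomogeneous hH]
      congr 2
      funext i
      fin_cases i <;> simp [mul_div_cancel₀, hv]
    rw [aux hF, aux hG, h]
  exact mul_left_cancel₀ (X_ne_zero _) key

theorem homogenization_affinePart {F : MvPolynomial (Fin 3) ℂ} {n : ℕ} (hF : F.IsHomogeneous n) :
    homogenization n (affinePart F) = F :=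
  affinePart_injective_of_isHomogeneous (isHomogeneous_homogenization _ _) hF
    (affinePart_homogenization (totalDegree_affinePart_le hF))

/-- The leading form of the affine part is the restriction to the line at infinity. -/
theorem homogeneousComponent_affinePart {F : MvPolynomial (Fin 3) ℂ} {n : ℕ}
    (hF : F.IsHomogeneous n) :
    homogeneousComponent n (affinePart F) = aeval ![X 0, X 1, 0] F := by
  conv_rhs => rw [← homogenization_affinePart hF]
  rw [aeval_homogenization_of_eq_zero _ _ _ (by simp)]
  conv_lhs => rw [← aeval_X_left_apply (homogeneousComponent n (affinePart F))]
  congr 2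
  funext i
  fin_cases i <;> rfl

/-- The degree hypothesis says that the line at infinity is not a component, so a factorization of
the affine part homogenizes to one of `F` itself. -/
theorem irreducible_affinePart {F : MvPolynomial (Fin 3) ℂ} (hF : F.IsHomogeneous
    (affinePart F).totalDegree) (hirr : Irreducible F) (h0 : (affinePart F).totalDegree ≠ 0) :
    Irreducible (affinePart F) := by
  refine ⟨fun hu => h0 ?_, fun u v huv => ?_⟩
  · obtain ⟨c, -, hc⟩ := isUnit_iff_eq_C_of_isReduced.mp hu
    rw [hc, totalDegree_C]
  · have hne : u * v ≠ 0 := by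
      rw [← huv]
      rintro h
      simp [h] at h0
    have hu := left_ne_zero_of_mul hne
    have hv := right_ne_zero_of_mul hne
    have hdeg : (affinePart F).totalDegree = u.totalDegree + v.totalDegree := by
      rw [huv, totalDegree_mul_of_isDomain hu hv]
    have hprod : F = homogenization u.totalDegree u * homogenization v.totalDegree v := by
      refine affinePart_injective_of_isHomogeneous hF ?_ ?_
      · rw [hdeg]
        exact (isHomogeneous_homogenization _ _).mul (isHomogeneous_homogenization _ _)
      · rw [huv]
        conv_lhs => rw [← affinePart_homogenization (le_refl u.totalDegree),
          ← affinePart_homogenization (le_refl v.totalDegree)]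
        simp [affinePart]
    have unit : ∀ w : MvPolynomial (Fin 2) ℂ, IsUnit (homogenization w.totalDegree w) →
        IsUnit w := by
      intro w hw
      have := hw.map (aeval ![X 0, X 1, 1] : MvPolynomial (Fin 3) ℂ →ₐ[ℂ] MvPolynomial (Fin 2) ℂ)
      change IsUnit (affinePart _) at this
      rwa [affinePart_homogenization le_rfl] at this
    exact (hirr.isUnit_or_isUnit hprod).imp (unit u) (unit v)

end Forms

/-! ### Finite intersections and real equations -/

/-- Each of the two quotients, by `f` and then by the nonzero class of `g` in the domain `R / f`,
lowers the Krull dimension by at least one. What remains is Artinian and has finitely many primes.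
-/
theorem finite_primes_containing_of_not_dvd {R : Type*} [CommRing R] [IsDomain R]
    [IsNoetherianRing R] (hR : ringKrullDim R ≤ 2) {f g : R} (hf : Prime f) (hfg : ¬ f ∣ g) :
    {J : Ideal R | J.IsPrime ∧ f ∈ J ∧ g ∈ J}.Finite := by
  have hI : (Ideal.span {f}).IsPrime := (Ideal.span_singleton_prime hf.ne_zero).mpr hf
  let gb : R ⧸ Ideal.span {f} := Ideal.Quotient.mk _ g
  have hgb : gb ≠ 0 := by
    rwa [Ne, Ideal.Quotient.eq_zero_iff_mem, Ideal.mem_span_singleton]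
  let B := (R ⧸ Ideal.span {f}) ⧸ Ideal.span {gb}
  have h1 : ringKrullDim (R ⧸ Ideal.span {f}) + 1 ≤ 2 :=
    (ringKrullDim_quotient_succ_le_of_nonZeroDivisor
      (mem_nonZeroDivisors_of_ne_zero hf.ne_zero)).trans hR
  have h2 : ringKrullDim B + 1 ≤ ringKrullDim (R ⧸ Ideal.span {f}) :=
    ringKrullDim_quotient_succ_le_of_nonZeroDivisor (mem_nonZeroDivisors_of_ne_zero hgb)
  have h3 : ringKrullDim B ≤ 0 := by
    have h4 : ringKrullDim (R ⧸ Ideal.span {f}) ≤ 1 := by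
      rw [← ENat.WithBot.add_le_add_one_right_iff, one_add_one_eq_two]
      exact h1
    rw [← ENat.WithBot.add_le_add_one_right_iff, zero_add]
    exact h2.trans h4
  have : Ring.KrullDimLE 0 B := by
    rw [Ring.KrullDimLE, Order.krullDimLE_iff, ← ringKrullDim]
    exact_mod_cast h3
  have : IsArtinianRing B := IsNoetherianRing.isArtinianRing_of_krullDimLE_zero
  let q : R →+* B := (Ideal.Quotient.mk _).comp (Ideal.Quotient.mk (Ideal.span {f}))
  have hq : Function.Surjective q :=
    Ideal.Quotient.mk_surjective.comp Ideal.Quotient.mk_surjective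
  have hfin : {J : Ideal B | J.IsPrime}.Finite := IsArtinianRing.setOfPred_isPrime_finite B
  refine (hfin.image (Ideal.comap q)).subset ?_
  rintro J ⟨hJ, hfJ, hgJ⟩
  have hker : RingHom.ker q ≤ J := by
    intro r hr
    rw [RingHom.mem_ker, RingHom.comp_apply, Ideal.Quotient.eq_zero_iff_mem,
      Ideal.mem_span_singleton] at hr
    obtain ⟨c, hc⟩ := hr
    obtain ⟨c, rfl⟩ := Ideal.Quotient.mk_surjective c
    rw [← map_mul, Ideal.Quotient.eq, Ideal.mem_span_singleton] at hc
    obtain ⟨d, hd⟩ := hc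
    rw [sub_eq_iff_eq_add.mp hd]
    exact J.add_mem (J.mul_mem_right _ hfJ) (J.mul_mem_right _ hgJ)
  refine ⟨J.map q, Ideal.map_isPrime_of_surjective hq hker, ?_⟩
  rw [Ideal.comap_map_of_surjective' q hq, sup_eq_left]
  exact hker

/-- Two plane curves without common component meet in finitely many points. -/
theorem finite_common_zeros {k : Type*} [Field k] {f g : MvPolynomial (Fin 2) k} (hf : Prime f)
    (hfg : ¬ f ∣ g) : {p : Fin 2 → k | eval p f = 0 ∧ eval p g = 0}.Finite := by
  have hR : ringKrullDim (MvPolynomial (Fin 2) k) ≤ 2 := by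
    rw [MvPolynomial.ringKrullDim_of_isNoetherianRing, ringKrullDim_eq_zero_of_field]
    simp
  refine Set.Finite.of_finite_image ((finite_primes_containing_of_not_dvd hR hf hfg).subset ?_)
    (f := fun p => RingHom.ker (eval p)) ?_
  · rintro _ ⟨p, ⟨hpf, hpg⟩, rfl⟩
    exact ⟨RingHom.ker_isPrime _, hpf, hpg⟩
  · intro p _ p' _ h
    funext i
    have : X i - C (p i) ∈ RingHom.ker (eval p') := by
      rw [← show RingHom.ker (eval p) = RingHom.ker (eval p') from h]
      simp [RingHom.mem_ker]
    simpa [RingHom.mem_ker, sub_eq_zero, eq_comm] using this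

/-- A real point of `f` is also a zero of the conjugate polynomial. Infinitely many common zeros
force `f` to divide its conjugate, and comparing degrees makes the quotient constant. -/
theorem map_star_eq_C_mul {f : MvPolynomial (Fin 2) ℂ} (hf : Irreducible f) (hreal : IsReal f) :
    ∃ c : ℂ, map (starRingEnd ℂ) f = C c * f := by
  have hdvd : f ∣ map (starRingEnd ℂ) f := by
    by_contra h
    refine hreal (Set.Finite.of_finite_image ((finite_common_zeros hf.prime h).subset ?_)
      (f := fun p : EuclideanSpace ℝ (Fin 2) => fun i => (p i : ℂ)) ?_)
    · rintro _ ⟨p, hp, rfl⟩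
      have hp' : eval (fun i => (p i : ℂ)) f = 0 := hp
      refine ⟨hp', ?_⟩
      have := congrArg (starRingEnd ℂ) hp'
      rw [← eval₂_id, hom_eval₂] at this
      rw [eval_map]
      simpa [Function.comp_def] using this
    · intro p _ q _ h
      ext i
      exact Complex.ofReal_injective (congrFun h i)
  obtain ⟨g, hg⟩ := hdvd
  have hne : map (starRingEnd ℂ) f ≠ 0 := by
    rw [Ne, map_eq_zero_iff _ (map_injective _ (starRingEnd ℂ).injective)]
    exact hf.ne_zero
  have hg0 : g ≠ 0 := by
    rintro rfl
    simp [hg] at hne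
  have hdeg : (map (starRingEnd ℂ) f).totalDegree ≤ f.totalDegree := by
    exact Finset.sup_mono (support_map_subset _ _)
  rw [hg, totalDegree_mul_of_isDomain hf.ne_zero hg0] at hdeg
  have : g = C (coeff 0 g) := totalDegree_eq_zero_iff_eq_C.mp (by omega)
  refine ⟨coeff 0 g, ?_⟩
  rw [← this, hg, mul_comm]

/-- If some coefficient of a real irreducible curve is real and nonzero, all are real. -/
theorem exists_map_ofReal {f : MvPolynomial (Fin 2) ℂ} (hf : Irreducible f) (hreal : IsReal f)
    {d : Fin 2 →₀ ℕ} (hd : coeff d f = 1) :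
    ∃ g : MvPolynomial (Fin 2) ℝ, map (algebraMap ℝ ℂ) g = f := by
  obtain ⟨c, hc⟩ := map_star_eq_C_mul hf hreal
  -- The coefficient 1 is fixed by conjugation, so the proportionality constant is 1.
  have h1 := congrArg (coeff d) hc
  rw [coeff_map, coeff_C_mul, hd, map_one, mul_one] at h1
  rw [← h1, C_1, one_mul] at hc
  rw [← Set.mem_range, mem_range_map_iff_coeffs_subset]
  intro z hz
  obtain ⟨m, -, rfl⟩ := mem_coeffs_iff.mp hz
  have h2 := congrArg (coeff m) hc
  rw [coeff_map] at h2
  obtain ⟨r, hr⟩ := Complex.conj_eq_iff_real.mp h2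
  exact ⟨r, by simp [hr]⟩

/-! ### Bounded distance between curves with the same leading form -/

open Filter Topology

/-- Strict differentiability is what allows the base point `a k` of the difference quotient to move.
-/
theorem tendsto_inv_mul_sub_of_hasStrictFDerivAt {E ι : Type*} [NormedAddCommGroup E]
    [NormedSpace ℝ E] {f : E → ℝ} {f' : E →L[ℝ] ℝ} {x : E} (hf : HasStrictFDerivAt f f' x)
    {l : Filter ι} {a : ι → E} {ε : ι → ℝ} (ha : Tendsto a l (𝓝 x)) (hε : Tendsto ε l (𝓝 0))
    (hne : ∀ᶠ k in l, ε k ≠ 0) (v : E) :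
    Tendsto (fun k => (ε k)⁻¹ * (f (a k + ε k • v) - f (a k))) l (𝓝 (f' v)) := by
  have h1 : Tendsto (fun k => (a k + ε k • v, a k)) l (𝓝 (x, x)) := by
    refine Tendsto.prodMk_nhds ?_ ha
    simpa using ha.add (hε.smul_const v)
  have h2 : (fun k => f (a k + ε k • v) - f (a k) - f' (ε k • v)) =o[l] ε := by
    have h3 := hf.isLittleO.comp_tendsto h1
    simp only [Function.comp_def, add_sub_cancel_left] at h3
    refine h3.trans_isBigO ?_
    refine Asymptotics.IsBigO.of_bound ‖v‖ (Eventually.of_forall fun k => ?_)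
    rw [norm_smul, mul_comm]
  have h4 := h2.tendsto_div_nhds_zero.add_const (f' v)
  rw [zero_add] at h4
  refine h4.congr' ?_
  filter_upwards [hne] with k hk
  rw [map_smul, smul_eq_mul]
  field_simp
  ring

/-- Two families of level sets with the same behaviour at infinity, which is transversal there, are
at bounded distance. Here `φ (x, 1)` and `ψ (x, 1)` are the equations, and `φ (x, 0) = ψ (x, 0)` is
their common leading form. -/
theorem exists_forall_exists_dist_le {E : Type*} [NormedAddCommGroup E] [NormedSpace ℝ E]
    [ProperSpace E] {φ ψ : E × ℝ → ℝ} {n : ℕ} (hφ : ContDiff ℝ 1 φ) (hψ : ContDiff ℝ 1 ψ)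
    (hφn : ∀ (r : ℝ) x, φ (r • x) = r ^ n * φ x) (hψn : ∀ (r : ℝ) x, ψ (r • x) = r ^ n * ψ x)
    (h0 : ∀ u, φ (u, 0) = ψ (u, 0))
    (hsimple : ∀ u ≠ 0, ψ (u, 0) = 0 → ∃ w, fderiv ℝ ψ (u, 0) (w, 0) ≠ 0)
    (hne : ∃ q, ψ (q, 1) = 0) :
    ∃ M : ℝ, ∀ p, φ (p, 1) = 0 → ∃ q, ψ (q, 1) = 0 ∧ dist p q ≤ M := by
  by_contra! hcon
  choose p hp hpd using fun k : ℕ => hcon k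
  obtain ⟨q₀, hq₀⟩ := hne
  have hnorm : Tendsto (fun k => ‖p k‖) atTop atTop := by
    refine tendsto_atTop_mono (fun k => ?_)
      (tendsto_atTop_add_const_right _ (-‖q₀‖) (tendsto_natCast_atTop_atTop (R := ℝ)))
    have h1 := hpd k q₀ hq₀
    have h2 := dist_le_norm_add_norm (p k) q₀
    linarith
  have hmem : ∀ k, ‖p k‖⁻¹ • p k ∈ Metric.closedBall (0 : E) 1 := by
    intro k
    rw [mem_closedBall_zero_iff, norm_smul, norm_inv, norm_norm]
    exact inv_mul_le_one_of_le₀ le_rfl (norm_nonneg _)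
  obtain ⟨u, -, σ, hσ, hu⟩ := (isCompact_closedBall (0 : E) 1).tendsto_subseq hmem
  set P : ℕ → E := fun k => p (σ k) with hP
  set ε : ℕ → ℝ := fun k => ‖P k‖⁻¹ with hεdef
  set U : ℕ → E := fun k => ε k • P k with hU
  replace hu : Tendsto U atTop (𝓝 u) := hu
  have hnormP : Tendsto (fun k => ‖P k‖) atTop atTop := hnorm.comp hσ.tendsto_atTop
  have hε : Tendsto ε atTop (𝓝 0) := tendsto_inv_atTop_zero.comp hnormP
  have hεpos : ∀ᶠ k in atTop, 0 < ε k := by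
    filter_upwards [hnormP.eventually_gt_atTop 0] with k hk using inv_pos.mpr hk
  have hεne : ∀ᶠ k in atTop, ε k ≠ 0 := hεpos.mono fun k hk => hk.ne'
  have hu0 : u ≠ 0 := by
    have h1 : Tendsto (fun k => ‖U k‖) atTop (𝓝 1) := by
      refine tendsto_const_nhds.congr' ?_
      filter_upwards [hεpos] with k hk
      rw [hU, norm_smul, Real.norm_of_nonneg hk.le, hεdef, inv_mul_cancel₀]
      exact (inv_pos.mp hk).ne'
    have h2 := tendsto_nhds_unique hu.norm h1
    rintro rfl
    simp at h2
  have hx : Tendsto (fun k => (U k, ε k)) atTop (𝓝 (u, 0)) := hu.prodMk_nhds hε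
  have hx0 : Tendsto (fun k => (U k, (0 : ℝ))) atTop (𝓝 (u, 0)) :=
    hu.prodMk_nhds tendsto_const_nhds
  have hφU : ∀ k, φ (U k, ε k) = 0 := by
    intro k
    have h1 := hφn (ε k) (P k, 1)
    rw [show φ (P k, 1) = 0 from hp (σ k), mul_zero] at h1
    simpa using h1
  have hφu : ψ (u, 0) = 0 := by
    rw [← h0]
    have h1 := (hφ.continuous.tendsto (u, 0)).comp hx
    refine tendsto_nhds_unique h1 ?_
    simp [Function.comp_def, hφU]
  obtain ⟨w₀, hw₀⟩ := hsimple u hu0 hφu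
  set ψ' := fderiv ℝ ψ (u, 0) with hψ'
  set φ' := fderiv ℝ φ (u, 0) with hφ'
  set w : E := (ψ' (w₀, 0))⁻¹ • w₀ with hw
  have hψw : ψ' (w, 0) = 1 := by
    have : ((w, 0) : E × ℝ) = (ψ' (w₀, 0))⁻¹ • (w₀, 0) := by simp [hw]
    rw [this, map_smul, smul_eq_mul, inv_mul_cancel₀ hw₀]
  -- The offset between the two curves along `w`, to first order at infinity: near a far point `P k`
  -- of the first, the second is expected at `P k - c • w`.
  set c : ℝ := ψ' (0, 1) - φ' (0, 1) with hc
  have hsψ : HasStrictFDerivAt ψ ψ' (u, 0) :=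
    hψ.contDiffAt.hasStrictFDerivAt (by norm_num)
  have hsφ : HasStrictFDerivAt φ φ' (u, 0) :=
    hφ.contDiffAt.hasStrictFDerivAt (by norm_num)
  -- Subtract the difference quotient of `φ` in direction `(0, 1)` from that of `ψ` in direction `(s
  -- • w, 1)`, both based at `(U k, 0)`. The base values cancel by `h0`, `φ (U k, ε k)` vanishes,
  -- and homogeneity rewrites the remaining term.
  have lim : ∀ s : ℝ, Tendsto (fun k => (ε k)⁻¹ * ((ε k) ^ n * ψ (P k + s • w, 1))) atTop
      (𝓝 (s + c)) := by
    intro s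
    have h1 := tendsto_inv_mul_sub_of_hasStrictFDerivAt hsψ hx0 hε hεne (s • w, 1)
    have h2 := tendsto_inv_mul_sub_of_hasStrictFDerivAt hsφ hx0 hε hεne (0, 1)
    have h3 : ψ' (s • w, 1) - φ' (0, 1) = s + c := by
      have : ((s • w, 1) : E × ℝ) = s • (w, 0) + (0, 1) := by simp
      rw [this, map_add, map_smul, hψw, hc, smul_eq_mul]
      ring
    rw [← h3]
    refine (h1.sub h2).congr fun k => ?_
    have h4 : (U k, (0 : ℝ)) + ε k • ((0 : E), (1 : ℝ)) = (U k, ε k) := by simp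
    have h5 : (U k, (0 : ℝ)) + ε k • (s • w, (1 : ℝ)) = ε k • (P k + s • w, 1) := by
      simp [hU]
    rw [h4, h5, hφU, hψn, h0]
    ring
  -- The limits at `s = -c + 1` and `s = -c - 1` are `1` and `-1`, so a zero lies between. Its
  -- distance from `P k` is at most `(|c| + 1) * ‖w‖`, which contradicts `hpd` once `k` is that
  -- large.
  have hpos := (lim (-c + 1)).eventually (lt_mem_nhds (show (0 : ℝ) < -c + 1 + c by norm_num))
  have hneg := (lim (-c - 1)).eventually (gt_mem_nhds (show -c - 1 + c < (0 : ℝ) by linarith))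
  obtain ⟨k, hk1, hk2, hk3, hk4⟩ := (hεpos.and (hpos.and (hneg.and
    ((tendsto_natCast_atTop_atTop (R := ℝ)).eventually_ge_atTop ((|c| + 1) * ‖w‖))))).exists
  have hin : 0 < (ε k)⁻¹ := inv_pos.mpr hk1
  have hpn : 0 < (ε k) ^ n := pow_pos hk1 n
  have hk2' : 0 < ψ (P k + (-c + 1) • w, 1) := by
    rwa [mul_pos_iff_of_pos_left hin, mul_pos_iff_of_pos_left hpn] at hk2
  have hk3' : ψ (P k + (-c - 1) • w, 1) < 0 := by
    by_contra! h
    exact absurd hk3 (not_lt.mpr (mul_nonneg hin.le (mul_nonneg hpn.le h)))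
  have hcont : Continuous fun s : ℝ => ψ (P k + s • w, 1) :=
    hψ.continuous.comp (by fun_prop)
  obtain ⟨s, ⟨hs1, hs2⟩, hs⟩ := intermediate_value_Icc (show -c - 1 ≤ -c + 1 by linarith)
    hcont.continuousOn ⟨hk3'.le, hk2'.le⟩
  have h1 := hpd (σ k) _ hs
  have h2 : dist (p (σ k)) (P k + s • w) = |s| * ‖w‖ := by
    rw [hP, dist_eq_norm, sub_add_cancel_left, norm_neg, norm_smul, Real.norm_eq_abs]
  have h3 : |s| ≤ |c| + 1 := by
    rw [abs_le]
    have := neg_abs_le c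
    have := le_abs_self c
    constructor <;> linarith
  have h4 : (k : ℝ) ≤ σ k := by exact_mod_cast hσ.le_apply
  have h5 := mul_le_mul_of_nonneg_right h3 (norm_nonneg w)
  linarith

theorem contDiff_eval {E σ : Type*} [NormedAddCommGroup E] [NormedSpace ℝ E] [Finite σ]
    (F : MvPolynomial σ ℝ) {v : E → σ → ℝ} {m : WithTop ℕ∞}
    (hv : ∀ i, ContDiff ℝ m fun x => v x i) : ContDiff ℝ m fun x => eval (v x) F := by
  induction F using MvPolynomial.induction_on with
  | C a => simpa using contDiff_const
  | add p q hp hq => simpa using hp.add hq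
  | mul_X p i hp => simpa using hp.mul (hv i)

/-- Two real plane curves with the same leading form, without multiple real linear factors, are at
bounded distance. -/
theorem exists_forall_exists_dist_le_of_homogeneousComponent_eq {f g : MvPolynomial (Fin 2) ℝ}
    {n : ℕ} (hf : f.totalDegree ≤ n) (hg : g.totalDegree ≤ n)
    (htop : homogeneousComponent n f = homogeneousComponent n g)
    (hsimple : ∀ u : Fin 2 → ℝ, u ≠ 0 → eval u (homogeneousComponent n g) = 0 →
      ∃ w : Fin 2 → ℝ,
        deriv (fun t : ℝ => eval (fun i => u i + t * w i) (homogeneousComponent n g)) 0 ≠ 0)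
    (hne : ∃ q : EuclideanSpace ℝ (Fin 2), eval (fun i => q i) g = 0) :
    ∃ M : ℝ, ∀ p : EuclideanSpace ℝ (Fin 2), eval (fun i => p i) f = 0 →
      ∃ q : EuclideanSpace ℝ (Fin 2), eval (fun i => q i) g = 0 ∧ dist p q ≤ M := by
  -- The homogenization as a function of the affine point and the homogenizing variable: height 1
  -- gives the curve, height 0 the leading form.
  let Φ : MvPolynomial (Fin 2) ℝ → EuclideanSpace ℝ (Fin 2) × ℝ → ℝ := fun h x =>
    eval ![x.1 0, x.1 1, x.2] (homogenization n h)
  have hsm : ∀ h, ContDiff ℝ 1 (Φ h) := by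
    intro h
    refine contDiff_eval _ fun i => ?_
    fin_cases i
    · show ContDiff ℝ 1 fun x : EuclideanSpace ℝ (Fin 2) × ℝ => x.1 0
      fun_prop
    · show ContDiff ℝ 1 fun x : EuclideanSpace ℝ (Fin 2) × ℝ => x.1 1
      fun_prop
    · show ContDiff ℝ 1 fun x : EuclideanSpace ℝ (Fin 2) × ℝ => x.2
      fun_prop
  have hhom : ∀ h (r : ℝ) x, Φ h (r • x) = r ^ n * Φ h x := by
    intro h r x
    rw [← eval_mul_of_isHomogeneous (isHomogeneous_homogenization n h)]
    show eval _ _ = _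
    congr 2
    funext i
    fin_cases i <;> simp
  have hzero : ∀ h (u : EuclideanSpace ℝ (Fin 2)),
      Φ h (u, 0) = eval (fun i => u i) (homogeneousComponent n h) := by
    intro h u
    refine (aeval_homogenization_of_eq_zero n h ![u 0, u 1, (0 : ℝ)] (by simp)).trans ?_
    show eval _ _ = _
    congr 2
    funext i
    fin_cases i <;> simp
  have hone : ∀ h : MvPolynomial (Fin 2) ℝ, h.totalDegree ≤ n →
      ∀ u : EuclideanSpace ℝ (Fin 2), Φ h (u, 1) = eval (fun i => u i) h := by
    intro h hh u
    refine (aeval_homogenization_of_eq_one hh ![u 0, u 1, (1 : ℝ)] (by simp)).trans ?_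
    show eval _ _ = _
    congr 2
    funext i
    fin_cases i <;> simp
  have main := exists_forall_exists_dist_le (n := n) (hsm f) (hsm g) (hhom f) (hhom g)
    (fun u => by rw [hzero, hzero, htop]) (fun u hu h => ?_)
    (hne.imp fun q hq => by rwa [hone g hg])
  · simpa only [hone f hf, hone g hg] using main
  · rw [hzero] at h
    obtain ⟨w, hw⟩ := hsimple (fun i => u i) (fun h0 => hu (by ext i; exact congrFun h0 i)) h
    let w' : EuclideanSpace ℝ (Fin 2) := WithLp.toLp 2 w
    refine ⟨w', ?_⟩
    convert! hw
    have h1 : HasFDerivAt (Φ g) (fderiv ℝ (Φ g) (u, 0)) ((u, 0) + (0 : ℝ) • (w', (0 : ℝ))) := by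
      rw [zero_smul, add_zero]
      exact ((hsm g).differentiable (by norm_num) _).hasFDerivAt
    have h2 : HasDerivAt (fun t : ℝ => ((u, 0) : EuclideanSpace ℝ (Fin 2) × ℝ) + t • (w', (0 : ℝ)))
        (w', 0) 0 := by
      simpa using ((hasDerivAt_id (0 : ℝ)).smul_const (w', (0 : ℝ))).const_add
        ((u, 0) : EuclideanSpace ℝ (Fin 2) × ℝ)
    have h3 := h1.comp_hasDerivAt 0 h2
    rw [← h3.deriv]
    congr 1
    funext t
    show Φ g ((u, 0) + t • (w', (0 : ℝ))) = _
    rw [show ((u, 0) : EuclideanSpace ℝ (Fin 2) × ℝ) + t • (w', (0 : ℝ)) = (u + t • w', 0) by simp,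
      hzero]
    rfl

/-! ### Counting zeros of binary forms -/

section LineRestriction

variable {k : Type*} [Field k]

/-- The restriction of `g` to the line `t ↦ v + t w`. -/
def restrictLine (g : MvPolynomial (Fin 2) k) (v w : Fin 2 → k) : Polynomial k :=
  aeval (fun i => Polynomial.C (v i) + Polynomial.X * Polynomial.C (w i)) g

theorem eval_restrictLine (g : MvPolynomial (Fin 2) k) (v w : Fin 2 → k) (t : k) :
    (restrictLine g v w).eval t = eval (fun i => v i + t * w i) g := by
  rw [restrictLine, ← Polynomial.coe_evalRingHom, ← Polynomial.coe_aeval_eq_evalRingHom]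
  show Polynomial.aeval t (aeval _ g) = aeval _ g
  rw [comp_aeval_apply]
  congr 2
  funext i
  simp
  ring

theorem natDegree_restrictLine_le {g : MvPolynomial (Fin 2) k} {n : ℕ} (hg : g.IsHomogeneous n)
    (v w : Fin 2 → k) : (restrictLine g v w).natDegree ≤ n := by
  have := aeval_natDegree_le g hg.totalDegree_le
    (fun i => Polynomial.C (v i) + Polynomial.X * Polynomial.C (w i)) (n := 1)
    (fun i => by compute_degree)
  simpa [restrictLine] using this

/-- By homogeneity, vanishing on `v + t w` for all `t` gives vanishing on `w + s v` for all `s ≠ 0`;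
as a polynomial in `s` this is then zero at `s = 0` as well, where its value is `eval w g`. -/
theorem restrictLine_ne_zero [Infinite k] {g : MvPolynomial (Fin 2) k} {n : ℕ}
    (hg : g.IsHomogeneous n) {v w : Fin 2 → k} (hw : eval w g ≠ 0) : restrictLine g v w ≠ 0 := by
  intro h
  have h1 : restrictLine g w v = 0 := by
    refine Polynomial.eq_zero_of_infinite_isRoot _ ((Set.finite_singleton (0 : k)).infinite_compl.mono
      fun s hs => ?_)
    have hs' : s ≠ 0 := hs
    rw [Set.mem_ofPred_eq, Polynomial.IsRoot, eval_restrictLine]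
    have h2 : (fun i => w i + s * v i) = fun i => s * (v i + s⁻¹ * w i) := by
      funext i
      field_simp
      ring
    rw [h2, eval_mul_of_isHomogeneous hg, ← eval_restrictLine, h]
    simp
  apply hw
  have h3 := eval_restrictLine g w v 0
  rw [h1] at h3
  simpa using h3.symm

theorem restrictLine_map {l : Type*} [Field l] (φ : k →+* l) (g : MvPolynomial (Fin 2) k)
    (v w : Fin 2 → k) :
    restrictLine (map φ g) (fun i => φ (v i)) (fun i => φ (w i)) = (restrictLine g v w).map φ := by
  induction g using MvPolynomial.induction_on with
  | C a => simp [restrictLine, Polynomial.algebraMap_eq]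
  | add p q hp hq => simp only [restrictLine, map_add, Polynomial.map_add] at *; rw [hp, hq]
  | mul_X p i hp => simp only [restrictLine, map_mul, Polynomial.map_mul] at *; rw [hp]; simp

end LineRestriction

/-- The zeros of a form on the line at infinity inject into the roots of its restriction to an
affine line, provided that the form does not vanish in the direction of the line. -/
theorem encard_le_card_roots {g : MvPolynomial (Fin 2) ℂ} {n : ℕ} (hg : g.IsHomogeneous n)
    {v w : Fin 2 → ℂ} (hw : eval w g ≠ 0) (hvw : v 0 * w 1 - v 1 * w 0 ≠ 0) {S : Set P2}
    (hS : ∀ Q ∈ S, Q.rep 2 = 0 ∧ eval ![Q.rep 0, Q.rep 1] g = 0) :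
    S.encard ≤ (restrictLine g v w).roots.toFinset.card := by
  set D := v 0 * w 1 - v 1 * w 0 with hD
  -- Cramer coordinates of `Q` in the basis `v`, `w`. The zero corresponds to the parameter `β / α`;
  -- `α ≠ 0` because the form does not vanish at `w`.
  let α : P2 → ℂ := fun Q => Q.rep 0 * w 1 - Q.rep 1 * w 0
  let β : P2 → ℂ := fun Q => v 0 * Q.rep 1 - v 1 * Q.rep 0
  have h0 : ∀ Q, D * Q.rep 0 = α Q * v 0 + β Q * w 0 := fun Q => by simp only [α, β, hD]; ring
  have h1 : ∀ Q, D * Q.rep 1 = α Q * v 1 + β Q * w 1 := fun Q => by simp only [α, β, hD]; ring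
  have hg0 : ∀ Q ∈ S, eval (fun i => D * ![Q.rep 0, Q.rep 1] i) g = 0 := fun Q hQ => by
    rw [eval_mul_of_isHomogeneous hg, (hS Q hQ).2, mul_zero]
  have hα : ∀ Q ∈ S, α Q ≠ 0 := by
    intro Q hQ h
    have h2 := hg0 Q hQ
    have h3 : (fun i => D * ![Q.rep 0, Q.rep 1] i) = fun i => β Q * w i := by
      funext i
      fin_cases i
      · simpa [h] using h0 Q
      · simpa [h] using h1 Q
    rw [h3, eval_mul_of_isHomogeneous hg] at h2
    have h4 : β Q = 0 := eq_zero_of_pow_eq_zero ((mul_eq_zero.mp h2).resolve_right hw)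
    apply Q.rep_nonzero
    funext i
    fin_cases i
    · simpa [h, h4, hvw] using h0 Q
    · simpa [h, h4, hvw] using h1 Q
    · exact (hS Q hQ).1
  rw [← Set.encard_coe_eq_coe_finsetCard]
  refine Set.encard_le_encard_of_injOn (f := fun Q => β Q / α Q) ?_ ?_
  · intro Q hQ
    have hαQ := hα Q hQ
    have h2 : eval (fun i => v i + β Q / α Q * w i) g = 0 := by
      have h3 : (fun i => D * ![Q.rep 0, Q.rep 1] i) =
          fun i => α Q * (v i + β Q / α Q * w i) := by
        funext i
        fin_cases i
        · simp only [Fin.zero_eta, Matrix.cons_val_zero, h0]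
          field_simp
        · simp only [Fin.mk_one, Matrix.cons_val_one, Matrix.cons_val_zero, h1]
          field_simp
      have h4 := hg0 Q hQ
      rw [h3, eval_mul_of_isHomogeneous hg] at h4
      exact (mul_eq_zero.mp h4).resolve_left (pow_ne_zero _ hαQ)
    simp only [Finset.mem_coe, Multiset.mem_toFinset,
      Polynomial.mem_roots (restrictLine_ne_zero hg hw), Polynomial.IsRoot, eval_restrictLine]
    exact h2
  · intro Q hQ Q' hQ' h
    have hαQ := hα Q hQ
    have hαQ' := hα Q' hQ'
    have h2 : β Q * α Q' = β Q' * α Q := (div_eq_div_iff hαQ hαQ').mp h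
    rw [← Q.mk_rep, ← Q'.mk_rep, Projectivization.mk_eq_mk_iff']
    refine ⟨α Q / α Q', ?_⟩
    funext i
    rw [Pi.smul_apply, smul_eq_mul, div_mul_eq_mul_div, div_eq_iff hαQ']
    refine mul_left_cancel₀ hvw ?_
    fin_cases i
    · show D * (α Q * Q'.rep 0) = D * (Q.rep 0 * α Q')
      linear_combination α Q * h0 Q' - α Q' * h0 Q - w 0 * h2
    · show D * (α Q * Q'.rep 1) = D * (Q.rep 1 * α Q')
      linear_combination α Q * h1 Q' - α Q' * h1 Q - w 1 * h2
    · show D * (α Q * Q'.rep 2) = D * (Q.rep 2 * α Q')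
      rw [(hS Q hQ).1, (hS Q' hQ').1]
      ring

theorem exists_eval_ne_zero {σ k : Type*} [Field k] [Infinite k] {g : MvPolynomial σ k}
    (hg : g ≠ 0) : ∃ w, eval w g ≠ 0 := by
  by_contra! h
  exact hg (MvPolynomial.funext fun w => by simpa using h w)

theorem exists_det_ne_zero {k : Type*} [Field k] {w : Fin 2 → k} (hw : w ≠ 0) :
    ∃ v : Fin 2 → k, v 0 * w 1 - v 1 * w 0 ≠ 0 := by
  by_cases h : w 0 = 0
  · refine ⟨![1, 0], ?_⟩
    intro h1
    apply hw
    funext i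
    fin_cases i
    · exact h
    · simpa using h1
  · exact ⟨![0, 1], by simpa using h⟩

theorem det_ne_zero_of_eval {k : Type*} [Field k] {g : MvPolynomial (Fin 2) k} {n : ℕ}
    (hg : g.IsHomogeneous n) {v w : Fin 2 → k} (hv0 : v ≠ 0) (hv : eval v g = 0)
    (hw : eval w g ≠ 0) : v 0 * w 1 - v 1 * w 0 ≠ 0 := by
  intro h
  apply hw
  have key : ∀ c : k, w = (fun i => c * v i) → eval w g = 0 := by
    rintro c rfl
    rw [eval_mul_of_isHomogeneous hg, hv, mul_zero]
  by_cases h0 : v 0 = 0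
  · have h1 : v 1 ≠ 0 := fun h1 => hv0 (by funext i; fin_cases i <;> assumption)
    refine key (w 1 / v 1) ?_
    funext i
    fin_cases i
    · have : w 0 = 0 := by simpa [h0, h1] using h
      simp [h0, this]
    · simp [h1]
  · refine key (w 0 / v 0) ?_
    funext i
    fin_cases i
    · simp [h0]
    · show w 1 = w 0 / v 0 * v 1
      field_simp
      linear_combination h

/-- A form of degree `n` vanishing at the `n` zeros of another one is a multiple of it. -/
theorem exists_eq_smul_of_vanishing {g h : MvPolynomial (Fin 2) ℂ} {n : ℕ}
    (hn : n ≠ 0) (hg : g.IsHomogeneous n) (hh : h.IsHomogeneous n) (hh0 : h ≠ 0) {S : Set P2}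
    (hcard : S.encard = n) (hSh : ∀ Q ∈ S, Q.rep 2 = 0 ∧ eval ![Q.rep 0, Q.rep 1] h = 0)
    (hSg : ∀ Q ∈ S, eval ![Q.rep 0, Q.rep 1] g = 0) : ∃ c : ℂ, g = c • h := by
  obtain ⟨w, hw⟩ := exists_eval_ne_zero hh0
  refine ⟨eval w g / eval w h, ?_⟩
  by_contra hne
  -- The scalar is chosen so that `r` also vanishes at `w`, a point where `h` does not. If nonzero,
  -- `r` would have `n + 1` zeros.
  set r := g - (eval w g / eval w h) • h with hr
  have hr0 : r ≠ 0 := sub_ne_zero.mpr hne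
  have hrn : r.IsHomogeneous n := by
    rw [hr, smul_eq_C_mul]
    exact hg.sub (hh.C_mul _)
  have hrw : eval w r = 0 := by
    rw [hr, smul_eq_C_mul]
    simp [hw]
  have hw0 : w ≠ 0 := by
    rintro rfl
    apply hw
    have := eval_mul_of_isHomogeneous hh 0 (0 : Fin 2 → ℂ)
    simpa [hn] using this
  let W : P2 := Projectivization.mk ℂ ![w 0, w 1, 0] (fun h0 => hw0 (by
    funext i
    fin_cases i
    · exact congrFun h0 0
    · exact congrFun h0 1))
  obtain ⟨a, ha⟩ := Projectivization.exists_smul_eq_mk_rep ℂ ![w 0, w 1, 0] (fun h0 => hw0 (by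
    funext i
    fin_cases i
    · exact congrFun h0 0
    · exact congrFun h0 1))
  have hW0 : ∀ i : Fin 2, ![W.rep 0, W.rep 1] i = a * w i := by
    intro i
    fin_cases i
    · exact (congrFun ha 0).symm
    · exact (congrFun ha 1).symm
  have hW : ∀ {q : MvPolynomial (Fin 2) ℂ}, q.IsHomogeneous n →
      eval ![W.rep 0, W.rep 1] q = a ^ n * eval w q := by
    intro q hq
    rw [← eval_mul_of_isHomogeneous hq]
    congr 2
    funext i
    exact hW0 i
  have hWS : W ∉ S := by
    intro hmem
    have h1 := (hSh W hmem).2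
    rw [hW hh] at h1
    exact mul_ne_zero (pow_ne_zero _ a.ne_zero) hw h1
  obtain ⟨w', hw'⟩ := exists_eval_ne_zero hr0
  have hw'0 : w' ≠ 0 := by
    rintro rfl
    apply hw'
    have := eval_mul_of_isHomogeneous hrn 0 (0 : Fin 2 → ℂ)
    simpa [hn] using this
  obtain ⟨v, hv⟩ := exists_det_ne_zero hw'0
  have hle := encard_le_card_roots hrn hw' hv (S := insert W S) (by
    intro Q hQ
    rcases Set.mem_insert_iff.mp hQ with rfl | hQ
    · refine ⟨?_, by rw [hW hrn, hrw, mul_zero]⟩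
      rw [← show _ = W.rep 2 from congrFun ha 2]
      simp
    · refine ⟨(hSh Q hQ).1, ?_⟩
      rw [hr, smul_eq_C_mul]
      simp [hSg Q hQ, (hSh Q hQ).2])
  rw [Set.encard_insert_of_notMem hWS, hcard] at hle
  have h1 : n + 1 ≤ (restrictLine r v w').roots.toFinset.card := by exact_mod_cast hle
  have h2 := Multiset.toFinset_card_le (restrictLine r v w').roots
  have h3 := Polynomial.card_roots' (restrictLine r v w')
  have h4 := natDegree_restrictLine_le hrn v w'
  omega

/-- The zeros of a form of degree `n` with `n` distinct zeros are simple. -/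
theorem eval_derivative_restrictLine_ne_zero {h : MvPolynomial (Fin 2) ℂ} {n : ℕ}
    (hh : h.IsHomogeneous n) {S : Set P2} (hcard : S.encard = n)
    (hSh : ∀ Q ∈ S, Q.rep 2 = 0 ∧ eval ![Q.rep 0, Q.rep 1] h = 0) {u w : Fin 2 → ℂ}
    (hu0 : u ≠ 0) (hu : eval u h = 0) (hw : eval w h ≠ 0) :
    (restrictLine h u w).derivative.eval 0 ≠ 0 := by
  have hq := restrictLine_ne_zero hh (v := u) hw
  have hle := encard_le_card_roots hh hw (det_ne_zero_of_eval hh hu0 hu hw) hSh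
  rw [hcard] at hle
  have h1 : n ≤ (restrictLine h u w).roots.toFinset.card := by exact_mod_cast hle
  have h2 := Multiset.toFinset_card_le (restrictLine h u w).roots
  have h3 := Polynomial.card_roots' (restrictLine h u w)
  have h4 := natDegree_restrictLine_le hh u w
  -- The bounds squeeze the number of distinct roots and the number of roots with multiplicity to
  -- the common value `n`.
  have hnodup : (restrictLine h u w).roots.Nodup :=
    Multiset.toFinset_card_eq_card_iff_nodup.mp (by omega)
  have hroot : (restrictLine h u w).IsRoot 0 := by
    rw [Polynomial.IsRoot, eval_restrictLine]
    simpa using hu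
  intro hd
  have h5 := (Polynomial.one_lt_rootMultiplicity_iff_isRoot hq).mpr ⟨hroot, hd⟩
  rw [← Polynomial.count_roots] at h5
  have h6 := Multiset.nodup_iff_count_le_one.mp hnodup 0
  omega

theorem homogeneousComponent_totalDegree_ne_zero {σ R : Type*} [CommSemiring R]
    {f : MvPolynomial σ R} (hf : f ≠ 0) : homogeneousComponent f.totalDegree f ≠ 0 := by
  obtain ⟨d, hd, hdeg⟩ := Finset.exists_mem_eq_sup f.support (support_nonempty.mpr hf)
    (fun s => s.sum fun _ e => e)
  intro h
  have h1 := coeff_homogeneousComponent f.totalDegree f d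
  rw [h, coeff_zero, if_pos (by rw [totalDegree, hdeg]; rfl)] at h1
  exact mem_support_iff.mp hd h1.symm

/-! ### Multiplicity at a point and the normal form of a curve -/

theorem mem_multAtLeast_iff {P : P2} {s : ℕ} {F : MvPolynomial (Fin 3) ℂ} :
    F ∈ multAtLeast P s ↔ shift P.rep F ∈ idealOfVars (Fin 3) ℂ ^ s :=
  (mem_pow_idealOfVars_iff' _ _).symm

theorem mem_multAtLeast_zero (P : P2) (F : MvPolynomial (Fin 3) ℂ) : F ∈ multAtLeast P 0 := by
  simp [mem_multAtLeast_iff]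

theorem mem_multAtLeast_one {P : P2} {F : MvPolynomial (Fin 3) ℂ} :
    F ∈ multAtLeast P 1 ↔ eval P.rep F = 0 := by
  have h : coeff 0 (shift P.rep F) = eval P.rep F := by
    rw [← constantCoeff_eq, shift]
    show constantCoeff (aeval (fun i => X i + C (P.rep i)) F) = _
    induction F using MvPolynomial.induction_on with
    | C a => simp [algebraMap_eq]
    | add p q hp hq => simp only [map_add, hp, hq]
    | mul_X p i hp => simp only [map_mul, hp, aeval_X, map_add, eval_X]; simp
  constructor
  · intro hF
    rw [← h]
    exact hF 0 (by simp)
  · intro hF d hd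
    have : d = 0 := by
      rw [← Finsupp.degree_eq_zero_iff]
      omega
    rw [this, h, hF]

theorem aeval_mem_pow_idealOfVars {σ τ R : Type*} [CommRing R] {g : σ → MvPolynomial τ R}
    (hg : ∀ i, g i ∈ idealOfVars τ R) {s : ℕ} {p : MvPolynomial σ R}
    (hp : p ∈ idealOfVars σ R ^ s) : aeval g p ∈ idealOfVars τ R ^ s := by
  have h1 : (idealOfVars σ R).map (aeval g : MvPolynomial σ R →ₐ[R] MvPolynomial τ R) ≤
      idealOfVars τ R := by
    rw [idealOfVars, Ideal.map_span, Ideal.span_le]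
    rintro _ ⟨_, ⟨i, rfl⟩, rfl⟩
    simpa using hg i
  have h2 := Ideal.mem_map_of_mem (aeval g : MvPolynomial σ R →ₐ[R] MvPolynomial τ R) hp
  rw [Ideal.map_pow] at h2
  exact Ideal.pow_right_mono h1 s h2

theorem mem_pow_idealOfVars_of_isHomogeneous {σ R : Type*} [CommRing R] {p : MvPolynomial σ R}
    {s : ℕ} (hp : p.IsHomogeneous s) : p ∈ idealOfVars σ R ^ s := by
  rw [mem_pow_idealOfVars_iff']
  exact fun x hx => hp.coeff_eq_zero hx.ne

theorem X_mem_idealOfVars {σ R : Type*} [CommRing R] (i : σ) :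
    (X i : MvPolynomial σ R) ∈ idealOfVars σ R := Ideal.subset_span ⟨i, rfl⟩

/-- Substitution of the linear forms `x - a z` and `y - b z` vanishing at the point `(a : b : 1)`. -/
def cone (a b : ℂ) : MvPolynomial (Fin 2) ℂ →ₐ[ℂ] MvPolynomial (Fin 3) ℂ :=
  aeval ![X 0 - C a * X 2, X 1 - C b * X 2]

/-- The translate of the affine part of a curve that moves the point `(a, b)` to the origin. -/
def affineGerm (a b : ℂ) (F : MvPolynomial (Fin 3) ℂ) : MvPolynomial (Fin 2) ℂ :=
  aeval ![X 0 + C a, X 1 + C b] (affinePart F)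

/-- The form with affine part `A (x - a, y - b) + B (x - a, y - b)`. -/
def coneForm (a b : ℂ) (A B : MvPolynomial (Fin 2) ℂ) : MvPolynomial (Fin 3) ℂ :=
  X 2 * cone a b A + cone a b B

theorem cone_isHomogeneous {a b : ℂ} {A : MvPolynomial (Fin 2) ℂ} {m : ℕ}
    (hA : A.IsHomogeneous m) : (cone a b A).IsHomogeneous m := by
  have := hA.aeval (S := ℂ) (n := 1) (τ := Fin 3) ![X 0 - C a * X 2, X 1 - C b * X 2] (fun i => by
    fin_cases i
    · exact (isHomogeneous_X _ _).sub (isHomogeneous_C_mul_X _ _)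
    · exact (isHomogeneous_X _ _).sub (isHomogeneous_C_mul_X _ _))
  rwa [one_mul] at this

theorem coneForm_isHomogeneous {a b : ℂ} {A B : MvPolynomial (Fin 2) ℂ} {m : ℕ}
    (hA : A.IsHomogeneous m) (hB : B.IsHomogeneous (m + 1)) :
    (coneForm a b A B).IsHomogeneous (m + 1) := by
  refine IsHomogeneous.add ?_ (cone_isHomogeneous hB)
  rw [add_comm]
  exact (isHomogeneous_X _ _).mul (cone_isHomogeneous hA)

theorem affineGerm_coneForm (a b : ℂ) (A B : MvPolynomial (Fin 2) ℂ) :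
    affineGerm a b (coneForm a b A B) = A + B := by
  have h : ∀ A, aeval ![X 0 + C a, X 1 + C b] (affinePart (cone a b A)) = A := by
    intro A
    rw [affinePart, cone, comp_aeval_apply, comp_aeval_apply]
    conv_rhs => rw [← aeval_X_left_apply A]
    congr 2
    funext i
    fin_cases i <;> simp [algebraMap_eq]
  rw [affineGerm, coneForm]
  simp only [affinePart, map_add, map_mul, aeval_X]
  have h' := h
  simp only [affinePart] at h'
  rw [h', h']
  simp

theorem affineGerm_injective (a b : ℂ) {F G : MvPolynomial (Fin 3) ℂ} {n : ℕ}
    (hF : F.IsHomogeneous n) (hG : G.IsHomogeneous n) (h : affineGerm a b F = affineGerm a b G) :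
    F = G := by
  refine affinePart_injective_of_isHomogeneous hF hG ?_
  have key : ∀ p : MvPolynomial (Fin 2) ℂ,
      aeval ![X 0 - C a, X 1 - C b] (aeval ![X 0 + C a, X 1 + C b] p) = p := by
    intro p
    rw [comp_aeval_apply]
    conv_rhs => rw [← aeval_X_left_apply p]
    congr 2
    funext i
    fin_cases i <;> simp [algebraMap_eq]
  rw [← key (affinePart F), ← key (affinePart G)]
  exact congrArg _ h

theorem totalDegree_affineGerm_le {a b : ℂ} {F : MvPolynomial (Fin 3) ℂ} {n : ℕ}
    (hF : F.IsHomogeneous n) : (affineGerm a b F).totalDegree ≤ n := by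
  refine (totalDegree_aeval_le_of_totalDegree_le_one _ _ fun i => ?_).trans
    (totalDegree_affinePart_le hF)
  fin_cases i
  · exact (totalDegree_add _ _).trans (by simp)
  · exact (totalDegree_add _ _).trans (by simp)

theorem exists_affinePoint_rep (a b : ℂ) :
    ∃ l : ℂ, l ≠ 0 ∧ (affinePoint a b).rep = ![l * a, l * b, l] := by
  obtain ⟨l, hl⟩ := Projectivization.exists_smul_eq_mk_rep ℂ ![a, b, 1]
    (fun h => one_ne_zero (congrFun h 2))
  refine ⟨l, l.ne_zero, ?_⟩
  rw [affinePoint, ← hl]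
  funext i
  fin_cases i <;> simp [Units.smul_def]

/-- With representative `(l a, l b, l)`, substituting `(l x, l y, 0)` into the shifted form gives `l
^ n` times the germ, and this substitution preserves order. -/
theorem affineGerm_mem_of_mem_multAtLeast {a b : ℂ} {F : MvPolynomial (Fin 3) ℂ} {n s : ℕ}
    (hF : F.IsHomogeneous n) (h : F ∈ multAtLeast (affinePoint a b) s) :
    affineGerm a b F ∈ idealOfVars (Fin 2) ℂ ^ s := by
  obtain ⟨l, hl, hrep⟩ := exists_affinePoint_rep a b
  rw [mem_multAtLeast_iff, hrep] at h
  have h1 := aeval_mem_pow_idealOfVars (τ := Fin 2) (g := ![C l * X 0, C l * X 1, 0]) (fun i => by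
    fin_cases i
    · exact Ideal.mul_mem_left _ _ (X_mem_idealOfVars 0)
    · exact Ideal.mul_mem_left _ _ (X_mem_idealOfVars 1)
    · exact Ideal.zero_mem _) h
  have h2 : aeval ![C l * X 0, C l * X 1, (0 : MvPolynomial (Fin 2) ℂ)]
      (shift ![l * a, l * b, l] F) = C l ^ n * affineGerm a b F := by
    rw [shift, affineGerm, affinePart, comp_aeval_apply, comp_aeval_apply,
      ← aeval_mul_of_isHomogeneous hF]
    congr 2
    funext i
    fin_cases i <;> simp [algebraMap_eq] <;> ring
  rw [h2, ← C_pow] at h1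
  have h3 := Ideal.mul_mem_left _ (C ((l ^ n)⁻¹)) h1
  rwa [← mul_assoc, ← C_mul, inv_mul_cancel₀ (pow_ne_zero _ hl), C_1, one_mul] at h3

/-- The linear forms `x - a z` and `y - b z` vanish at the point, so the shift leaves cones
unchanged and only moves the factor `X 2`. -/
theorem coneForm_mem_multAtLeast {a b : ℂ} {A B : MvPolynomial (Fin 2) ℂ} {m : ℕ}
    (hA : A.IsHomogeneous m) (hB : B.IsHomogeneous (m + 1)) :
    coneForm a b A B ∈ multAtLeast (affinePoint a b) m := by
  obtain ⟨l, hl, hrep⟩ := exists_affinePoint_rep a b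
  have hs : ∀ A, shift (affinePoint a b).rep (cone a b A) = cone a b A := by
    intro A
    rw [hrep, shift, cone, comp_aeval_apply]
    congr 2
    funext i
    fin_cases i <;> simp [algebraMap_eq] <;> ring
  rw [mem_multAtLeast_iff, coneForm, map_add, map_mul, hs, hs]
  refine Ideal.add_mem _ (Ideal.mul_mem_left _ _ ?_) ?_
  · exact mem_pow_idealOfVars_of_isHomogeneous (cone_isHomogeneous hA)
  · exact Ideal.pow_le_pow_right (Nat.le_succ m)
      (mem_pow_idealOfVars_of_isHomogeneous (cone_isHomogeneous hB))

theorem coneForm_notMem_multAtLeast {a b : ℂ} {A B : MvPolynomial (Fin 2) ℂ} {m : ℕ}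
    (hA : A.IsHomogeneous m) (hB : B.IsHomogeneous (m + 1)) (hA0 : A ≠ 0) :
    coneForm a b A B ∉ multAtLeast (affinePoint a b) (m + 1) := by
  intro h
  have h1 := affineGerm_mem_of_mem_multAtLeast (coneForm_isHomogeneous hA hB) h
  rw [affineGerm_coneForm, mem_pow_idealOfVars_iff'] at h1
  apply hA0
  ext d
  by_cases hd : d.degree = m
  · have h2 := h1 d (by omega)
    rwa [coeff_add, hB.coeff_eq_zero (by omega), add_zero] at h2
  · exact hA.coeff_eq_zero hd

/-- A form of degree `m + 1` with a point of multiplicity `m` at `(a : b : 1)`. -/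
theorem exists_eq_coneForm {a b : ℂ} {F : MvPolynomial (Fin 3) ℂ} {m : ℕ}
    (hF : F.IsHomogeneous (m + 1)) (h : F ∈ multAtLeast (affinePoint a b) m) :
    ∃ A B : MvPolynomial (Fin 2) ℂ, A.IsHomogeneous m ∧ B.IsHomogeneous (m + 1) ∧
      F = coneForm a b A B := by
  have h1 := affineGerm_mem_of_mem_multAtLeast hF h
  rw [mem_pow_idealOfVars_iff'] at h1
  refine ⟨homogeneousComponent m (affineGerm a b F),
    homogeneousComponent (m + 1) (affineGerm a b F), homogeneousComponent_isHomogeneous _ _,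
    homogeneousComponent_isHomogeneous _ _, ?_⟩
  refine affineGerm_injective a b hF (coneForm_isHomogeneous
    (homogeneousComponent_isHomogeneous _ _) (homogeneousComponent_isHomogeneous _ _)) ?_
  rw [affineGerm_coneForm]
  -- The germ has degree at most `m + 1`, and all its components below degree `m` vanish.
  conv_lhs => rw [← sum_homogeneousComponent_of_le (totalDegree_affineGerm_le (a := a) (b := b) hF)]
  rw [Finset.sum_range_succ, Finset.sum_range_succ, Finset.sum_eq_zero, zero_add]
  intro j hj
  refine homogeneousComponent_eq_zero' _ _ fun d hd => ?_
  intro hdj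
  rw [mem_support_iff] at hd
  exact hd (h1 d (by have := Finset.mem_range.mp hj; omega))

theorem eval_coneForm (a b : ℂ) (A B : MvPolynomial (Fin 2) ℂ) (v : Fin 3 → ℂ) :
    eval v (coneForm a b A B) = v 2 * eval ![v 0 - a * v 2, v 1 - b * v 2] A +
      eval ![v 0 - a * v 2, v 1 - b * v 2] B := by
  have h : ∀ A, eval v (cone a b A) = eval ![v 0 - a * v 2, v 1 - b * v 2] A := by
    intro A
    show aeval v (aeval _ A) = aeval _ A
    rw [comp_aeval_apply]
    congr 2
    funext i
    fin_cases i <;> simp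
  rw [coneForm, map_add, map_mul, eval_X, h, h]

theorem homogeneousComponent_affinePart_coneForm {a b : ℂ} {A B : MvPolynomial (Fin 2) ℂ} {m : ℕ}
    (hA : A.IsHomogeneous m) (hB : B.IsHomogeneous (m + 1)) :
    homogeneousComponent (m + 1) (affinePart (coneForm a b A B)) = B := by
  rw [homogeneousComponent_affinePart (coneForm_isHomogeneous hA hB), coneForm, map_add, map_mul,
    aeval_X, cone, comp_aeval_apply]
  simp only [Matrix.cons_val, zero_mul, zero_add]
  rw [comp_aeval_apply]
  conv_rhs => rw [← aeval_X_left_apply B]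
  congr 2
  funext i
  fin_cases i <;> simp

/-! ### The linear system and its dimension -/

section LinearSystem

variable {f : MvPolynomial (Fin 2) ℂ}

theorem mem_linearSystem_iff (hfin : (pointsAtInfinity f).Finite) {a b : ℂ} {n s : ℕ}
    {F : MvPolynomial (Fin 3) ℂ} :
    F ∈ linearSystem n (hausdorffDivisor f + Finsupp.single (affinePoint a b) s) ↔
      F.IsHomogeneous n ∧ F ∈ multAtLeast (affinePoint a b) s ∧
        ∀ Q ∈ pointsAtInfinity f, eval Q.rep F = 0 := by
  classical
  have hD : ∀ P, hausdorffDivisor f P = if P ∈ pointsAtInfinity f then 1 else 0 := by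
    intro P
    rw [hausdorffDivisor, finsum_mem_eq_finite_toFinset_sum _ hfin, Finsupp.finsetSum_apply]
    simp [Finsupp.single_apply]
  -- The two summands of the divisor have disjoint supports, so no multiplicities add up.
  have hP : affinePoint a b ∉ pointsAtInfinity f := by
    obtain ⟨l, hl, hrep⟩ := exists_affinePoint_rep a b
    rintro ⟨h, -⟩
    rw [hrep] at h
    exact hl (by simpa using h)
  rw [linearSystem, Submodule.mem_inf, mem_homogeneousSubmodule, Submodule.mem_iInf]
  refine and_congr_right fun hF => ⟨fun h => ⟨?_, fun Q hQ => ?_⟩, fun ⟨h1, h2⟩ P => ?_⟩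
  · simpa [hD, hP] using h (affinePoint a b)
  · have hne : affinePoint a b ≠ Q := fun h => hP (h ▸ hQ)
    have := h Q
    rwa [Finsupp.add_apply, hD, if_pos hQ, Finsupp.single_eq_of_ne (Ne.symm hne), add_zero,
      mem_multAtLeast_one] at this
  · by_cases hPe : P = affinePoint a b
    · rw [hPe]
      simpa [hD, hP] using h1
    · rw [Finsupp.add_apply, hD, Finsupp.single_eq_of_ne hPe, add_zero]
      split_ifs with h
      · exact mem_multAtLeast_one.mpr (h2 P h)
      · exact mem_multAtLeast_zero _ _

theorem mem_linearSystem_iff_exists_coneForm {m : ℕ} (hdeg : f.totalDegree = m + 1)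
    (hhaus : IsHausdorffCurve f) {a b : ℂ} {F : MvPolynomial (Fin 3) ℂ} :
    F ∈ linearSystem (m + 1) (hausdorffDivisor f + Finsupp.single (affinePoint a b) m) ↔
      ∃ (A : MvPolynomial (Fin 2) ℂ) (c : ℂ), A.IsHomogeneous m ∧
        F = coneForm a b A (c • homogeneousComponent (m + 1) f) := by
  have hcard : (pointsAtInfinity f).encard = (m + 1 : ℕ) := by rw [hhaus, hdeg]
  have hfin : (pointsAtInfinity f).Finite := Set.finite_of_encard_eq_coe hcard
  have hpts : ∀ Q ∈ pointsAtInfinity f, Q.rep 2 = 0 ∧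
      eval ![Q.rep 0, Q.rep 1] (homogeneousComponent (m + 1) f) = 0 := by
    intro Q hQ
    rw [← hdeg]
    exact hQ
  have hev : ∀ (A B : MvPolynomial (Fin 2) ℂ), ∀ Q ∈ pointsAtInfinity f,
      eval Q.rep (coneForm a b A B) = eval ![Q.rep 0, Q.rep 1] B := by
    intro A B Q hQ
    simp [eval_coneForm, (hpts Q hQ).1]
  have hh0 : homogeneousComponent (m + 1) f ≠ 0 := by
    rw [← hdeg]
    refine homogeneousComponent_totalDegree_ne_zero ?_
    rintro rfl
    simp at hdeg
  rw [mem_linearSystem_iff hfin]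
  constructor
  · rintro ⟨hF, hmul, hinf⟩
    obtain ⟨A, B, hA, hB, rfl⟩ := exists_eq_coneForm hF hmul
    obtain ⟨c, rfl⟩ := exists_eq_smul_of_vanishing (Nat.succ_ne_zero m) hB
      (homogeneousComponent_isHomogeneous (m + 1) f) hh0 hcard hpts
      (fun Q hQ => by rw [← hev A B Q hQ, hinf Q hQ])
    exact ⟨A, c, hA, rfl⟩
  · rintro ⟨A, c, hA, rfl⟩
    have hB : (c • homogeneousComponent (m + 1) f).IsHomogeneous (m + 1) := by
      rw [smul_eq_C_mul]
      exact (homogeneousComponent_isHomogeneous (m + 1) f).C_mul c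
    refine ⟨coneForm_isHomogeneous hA hB, coneForm_mem_multAtLeast hA hB, fun Q hQ => ?_⟩
    rw [hev _ _ Q hQ, smul_eval, (hpts Q hQ).2, mul_zero]

/-- The linear system as the image of a space of parameters. -/
def linearSystemParam (f : MvPolynomial (Fin 2) ℂ) (m : ℕ) (a b : ℂ) :
    Polynomial.degreeLT ℂ (m + 1) × ℂ →ₗ[ℂ] MvPolynomial (Fin 3) ℂ :=
  (LinearMap.mulLeft ℂ (X 2) ∘ₗ (cone a b).toLinearMap ∘ₗ Polynomial.homogenizeLM m ∘ₗ
    (Polynomial.degreeLT ℂ (m + 1)).subtype ∘ₗ LinearMap.fst ℂ _ _) +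
  (LinearMap.snd ℂ _ _).smulRight (cone a b (homogeneousComponent (m + 1) f))

theorem linearSystemParam_apply (m : ℕ) (a b : ℂ) (x) :
    linearSystemParam f m a b x = coneForm a b (Polynomial.homogenize (x.1 : Polynomial ℂ) m)
      (x.2 • homogeneousComponent (m + 1) f) := by
  simp [linearSystemParam, coneForm]

theorem projDim_linearSystem {m : ℕ} (hdeg : f.totalDegree = m + 1)
    (hhaus : IsHausdorffCurve f) (a b : ℂ) :
    projDim (linearSystem (m + 1)
      (hausdorffDivisor f + Finsupp.single (affinePoint a b) m)) = (m + 1 : ℕ) := by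
  have hrange : LinearMap.range (linearSystemParam f m a b) =
      linearSystem (m + 1) (hausdorffDivisor f + Finsupp.single (affinePoint a b) m) := by
    ext F
    rw [LinearMap.mem_range, mem_linearSystem_iff_exists_coneForm hdeg hhaus]
    constructor
    · rintro ⟨x, rfl⟩
      exact ⟨_, x.2, Polynomial.isHomogeneous_homogenize _, linearSystemParam_apply _ _ _ _⟩
    · rintro ⟨A, c, hA, rfl⟩
      have hp : (aeval ![Polynomial.X, 1] A : Polynomial ℂ).natDegree ≤ m := by
        have := aeval_natDegree_le A hA.totalDegree_le ![Polynomial.X, (1 : Polynomial ℂ)]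
          (n := 1) (fun i => by fin_cases i <;> simp)
        simpa using this
      refine ⟨(⟨aeval ![Polynomial.X, 1] A, ?_⟩, c), ?_⟩
      · rw [Polynomial.mem_degreeLT]
        exact lt_of_le_of_lt Polynomial.degree_le_natDegree (by exact_mod_cast Nat.lt_succ_of_le hp)
      · rw [linearSystemParam_apply, Polynomial.homogenize_eq_of_isHomogeneous hA rfl]
  have hh0 : homogeneousComponent (m + 1) f ≠ 0 := by
    rw [← hdeg]
    refine homogeneousComponent_totalDegree_ne_zero ?_
    rintro rfl
    simp at hdeg
  -- The leading form of the affine part recovers `c`; once `c = 0`, the germ at `(a, b)` recovers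
  -- the other parameter.
  have hinj : Function.Injective (linearSystemParam f m a b) := by
    rw [← LinearMap.ker_eq_bot, LinearMap.ker_eq_bot']
    rintro ⟨p, c⟩ h
    rw [linearSystemParam_apply] at h
    have h1 := affineGerm_coneForm a b (Polynomial.homogenize (p : Polynomial ℂ) m)
      (c • homogeneousComponent (m + 1) f)
    have h2 := homogeneousComponent_affinePart_coneForm (a := a) (b := b)
      (Polynomial.isHomogeneous_homogenize (n := m) (p : Polynomial ℂ))
      (homogeneousComponent_isHomogeneous (m + 1) (c • f))
    rw [map_smul, h, affinePart, map_zero, map_zero] at h2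
    have hc : c = 0 := (smul_eq_zero.mp h2.symm).resolve_right hh0
    rw [h, affineGerm, affinePart, map_zero, map_zero, hc, zero_smul, add_zero] at h1
    have hp : (p : Polynomial ℂ).natDegree ≤ m :=
      Polynomial.natDegree_le_iff_coeff_eq_zero.mpr fun j hj =>
        (Polynomial.degree_lt_iff_coeff_zero _ _).mp (Polynomial.mem_degreeLT.mp p.2) j hj
    have hp0 : p = 0 := Subtype.ext (Polynomial.eq_zero_of_homogenize_eq_zero hp h1.symm)
    rw [hp0, hc]
    rfl
  rw [projDim, ← hrange, LinearMap.finrank_range_of_inj hinj, Module.finrank_prod,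
    (Polynomial.degreeLTEquiv ℂ (m + 1)).finrank_eq]
  simp

end LinearSystem

/-! ### Irreducible members are monomial and rational -/

theorem aeval_sub_aeval_mem {σ R A : Type*} [CommRing R] [CommRing A] [Algebra R A] {I : Ideal A}
    {g g' : σ → A} (h : ∀ i, g i - g' i ∈ I) (p : MvPolynomial σ R) :
    aeval g p - aeval g' p ∈ I := by
  rw [← Ideal.Quotient.eq, ← Ideal.Quotient.mkₐ_eq_mk R, comp_aeval_apply, comp_aeval_apply]
  congr 2
  funext i
  exact Ideal.Quotient.eq.mpr (h i)

/-- The linear form vanishing at `u`. -/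
def linearFormAt (u : Fin 2 → ℂ) : MvPolynomial (Fin 2) ℂ := C (u 1) * X 0 - C (u 0) * X 1

/-- Modulo the linear form, `u j * X i` is congruent to `X j * u i`. Hence `u j ^ n * h` is
congruent to `X j ^ n * h(u) = 0`, and some `u j` is invertible. -/
theorem linearFormAt_dvd {h : MvPolynomial (Fin 2) ℂ} {n : ℕ} (hh : h.IsHomogeneous n)
    {u : Fin 2 → ℂ} (hu0 : u ≠ 0) (hu : eval u h = 0) : linearFormAt u ∣ h := by
  have key : ∀ j : Fin 2, linearFormAt u ∣ C (u j ^ n) * h := by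
    intro j
    have h1 : aeval (fun i => C (u j) * X i) h - aeval (fun i => X j * C (u i)) h ∈
        Ideal.span {linearFormAt u} := by
      refine aeval_sub_aeval_mem (fun i => ?_) h
      rw [Ideal.mem_span_singleton, linearFormAt]
      fin_cases j <;> fin_cases i
      · exact ⟨0, by simp; ring⟩
      · exact ⟨-1, by simp; ring⟩
      · exact ⟨1, by simp; ring⟩
      · exact ⟨0, by simp; ring⟩
    have h2 : aeval (fun i => C (u i)) h = (C (eval u h) : MvPolynomial (Fin 2) ℂ) := by
      show _ = algebraMap ℂ (MvPolynomial (Fin 2) ℂ) (aeval u h)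
      rw [← aeval_algebraMap_apply]
      rfl
    rwa [aeval_mul_of_isHomogeneous hh, aeval_mul_of_isHomogeneous hh, h2, hu, C_0, mul_zero,
      sub_zero, Ideal.mem_span_singleton, aeval_X_left_apply, ← C_pow] at h1
  obtain ⟨j, hj⟩ := Function.ne_iff.mp hu0
  have h3 := (key j).mul_left (C ((u j ^ n)⁻¹))
  rwa [← mul_assoc, ← C_mul, inv_mul_cancel₀ (pow_ne_zero _ hj), C_1, one_mul] at h3

theorem eq_zero_of_isHomogeneous_dvd {σ : Type*} {F G : MvPolynomial σ ℂ} {m : ℕ}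
    (hF : Irreducible F) (hFm : F.IsHomogeneous (m + 1)) (hG : G.IsHomogeneous 1) (h : G ∣ F) :
    m = 0 := by
  obtain ⟨u, hu⟩ := h
  have hG0 : G ≠ 0 := by
    rintro rfl
    rw [zero_mul] at hu
    exact hF.ne_zero hu
  have hu0 : u ≠ 0 := by
    rintro rfl
    rw [mul_zero] at hu
    exact hF.ne_zero hu
  have hdeg : ∀ w : MvPolynomial σ ℂ, IsUnit w → w.totalDegree = 0 := by
    intro w hw
    obtain ⟨c, -, hc⟩ := isUnit_iff_eq_C_of_isReduced.mp hw
    rw [hc, totalDegree_C]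
  have h1 := hFm.totalDegree hF.ne_zero
  rw [hu, totalDegree_mul_of_isDomain hG0 hu0, hG.totalDegree hG0] at h1
  rcases hF.isUnit_or_isUnit hu with h2 | h2
  · have := hdeg _ h2
    rw [hG.totalDegree hG0] at this
    omega
  · have := hdeg _ h2
    omega

theorem linearFormAt_isHomogeneous (u : Fin 2 → ℂ) : (linearFormAt u).IsHomogeneous 1 :=
  (isHomogeneous_C_mul_X _ _).sub (isHomogeneous_C_mul_X _ _)

theorem cone_linearFormAt_dvd_coneForm {a b : ℂ} {A B : MvPolynomial (Fin 2) ℂ} {m : ℕ}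
    (hA : A.IsHomogeneous m) (hB : B.IsHomogeneous (m + 1)) {u : Fin 2 → ℂ} (hu0 : u ≠ 0)
    (huA : eval u A = 0) (huB : eval u B = 0) :
    cone a b (linearFormAt u) ∣ coneForm a b A B :=
  dvd_add (((_root_.map_dvd (cone a b) (linearFormAt_dvd hA hu0 huA))).mul_left _)
    (_root_.map_dvd (cone a b) (linearFormAt_dvd hB hu0 huB))

/-- If `A ≠ 0`, the multiplicity at `(a : b : 1)` is exactly `m`. If `A = 0`, the curve is a cone
containing the line over `u`, so irreducibility forces `m = 0` and any point off the curve has the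
required multiplicity 0. -/
theorem isMonomialCurve_coneForm {a b : ℂ} {A B : MvPolynomial (Fin 2) ℂ} {m : ℕ}
    (hA : A.IsHomogeneous m) (hB : B.IsHomogeneous (m + 1)) {u : Fin 2 → ℂ} (hu0 : u ≠ 0)
    (hu : eval u B = 0) (hirr : Irreducible (coneForm a b A B)) :
    IsMonomialCurve (coneForm a b A B) := by
  have hF := coneForm_isHomogeneous (a := a) (b := b) hA hB
  refine ⟨hirr, m, hF, ?_⟩
  by_cases hA0 : A = 0
  · have hm : m = 0 := eq_zero_of_isHomogeneous_dvd hirr hF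
      (cone_isHomogeneous (linearFormAt_isHomogeneous u))
      (cone_linearFormAt_dvd_coneForm hA hB hu0 (by simp [hA0]) hu)
    subst hm
    obtain ⟨w, hw⟩ := exists_eval_ne_zero hirr.ne_zero
    have hw0 : w ≠ 0 := by
      rintro rfl
      apply hw
      have := eval_mul_of_isHomogeneous hF 0 (0 : Fin 3 → ℂ)
      simpa using this
    refine ⟨Projectivization.mk ℂ w hw0, mem_multAtLeast_zero _ _, fun h => ?_⟩
    rw [zero_add, mem_multAtLeast_one] at h
    obtain ⟨r, hr⟩ := Projectivization.exists_smul_eq_mk_rep ℂ w hw0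
    rw [← hr] at h
    have h1 := eval_mul_of_isHomogeneous hF (r : ℂ) w
    rw [show (fun i => (r : ℂ) * w i) = r • w from rfl, h] at h1
    exact mul_ne_zero (pow_ne_zero _ r.ne_zero) hw h1.symm
  · exact ⟨affinePoint a b, coneForm_mem_multAtLeast hA hB,
      coneForm_notMem_multAtLeast hA hB hA0⟩

theorem aeval_coneForm {R : Type*} [CommRing R] [Algebra ℂ R] (a b : ℂ)
    (A B : MvPolynomial (Fin 2) ℂ) (x y z : R) :
    aeval ![x + algebraMap ℂ R a * z, y + algebraMap ℂ R b * z, z] (coneForm a b A B) =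
      z * aeval ![x, y] A + aeval ![x, y] B := by
  have h : ∀ A, aeval ![x + algebraMap ℂ R a * z, y + algebraMap ℂ R b * z, z] (cone a b A) =
      aeval ![x, y] A := by
    intro A
    rw [cone, comp_aeval_apply]
    congr 2
    funext i
    fin_cases i <;> simp
  rw [coneForm, map_add, map_mul, aeval_X, h, h]
  rfl

/-- The polynomial `A (t, 1)`. -/
def dehomogenization {k : Type*} [Field k] (A : MvPolynomial (Fin 2) k) : Polynomial k :=
  aeval ![Polynomial.X, 1] A

theorem dehomogenization_ne_zero {k : Type*} [Field k] {A : MvPolynomial (Fin 2) k} {m : ℕ}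
    (hA : A.IsHomogeneous m) (hA0 : A ≠ 0) : dehomogenization A ≠ 0 := by
  intro h
  apply hA0
  rw [← Polynomial.homogenize_eq_of_isHomogeneous hA h, Polynomial.homogenize_zero]

theorem eval_dehomogenization {k : Type*} [Field k] (A : MvPolynomial (Fin 2) k) (t : k) :
    (dehomogenization A).eval t = eval ![t, 1] A := by
  rw [dehomogenization, ← Polynomial.coe_evalRingHom, ← Polynomial.coe_aeval_eq_evalRingHom]
  show Polynomial.aeval t (aeval _ A) = aeval _ A
  rw [comp_aeval_apply]
  congr 2
  funext i
  fin_cases i <;> simp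

theorem aeval_mul_X_self {k : Type*} [Field k] {A : MvPolynomial (Fin 2) k} {m : ℕ}
    (hA : A.IsHomogeneous m) (q : Polynomial k) :
    aeval ![q * Polynomial.X, q] A = q ^ m * dehomogenization A := by
  rw [dehomogenization, ← aeval_mul_of_isHomogeneous hA]
  congr 2
  funext i
  fin_cases i <;> simp

theorem exists_natDegree_pos {k : Type*} [Field k] {p q : Polynomial k} (hp : p ≠ 0) (a b : k) :
    ∃ i, 0 < (![p * Polynomial.X + Polynomial.C a * q, p + Polynomial.C b * q, q] i).natDegree := by
  by_contra! h
  have h0 := h 0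
  have h1 := h 1
  have h2 : q.natDegree ≤ 0 := h 2
  simp only [Matrix.cons_val] at h0 h1
  have hc : ∀ c : k, (Polynomial.C c * q).natDegree ≤ 0 := fun c =>
    (Polynomial.natDegree_C_mul_le c q).trans h2
  have h3 : (p * Polynomial.X).natDegree ≤ 0 := by
    rw [← add_sub_cancel_right (p * Polynomial.X) (Polynomial.C a * q)]
    exact (Polynomial.natDegree_sub_le _ _).trans (max_le h0 (hc a))
  rw [Polynomial.natDegree_mul_X hp] at h3
  omega

/-- The line of slope parameter `t` through `(a : b : 1)` meets the curve residually where `z A(t,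
1) + B(t, 1)`, scaled, vanishes; clearing denominators gives the parametrization when `A ≠ 0`. -/
theorem isRational_coneForm {a b : ℂ} {A B : MvPolynomial (Fin 2) ℂ} {m : ℕ}
    (hA : A.IsHomogeneous m) (hB : B.IsHomogeneous (m + 1)) {u : Fin 2 → ℂ} (hu0 : u ≠ 0)
    (hu : eval u B = 0) (hirr : Irreducible (coneForm a b A B)) :
    IsRational (coneForm a b A B) := by
  by_cases hA0 : A = 0
  -- For `A = 0`, parametrize the line joining `(a : b : 1)` to the point at infinity `(u 0 : u 1 :
  -- 0)`.
  · refine ⟨![Polynomial.C (u 0) + Polynomial.C a * Polynomial.X,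
      Polynomial.C (u 1) + Polynomial.C b * Polynomial.X, Polynomial.X], ⟨2, by simp⟩,
      fun q hq => ?_, ?_⟩
    · have h2 : q ∣ Polynomial.X := hq 2
      obtain ⟨j, hj⟩ := Function.ne_iff.mp hu0
      have h3 : q ∣ Polynomial.C (u j) := by
        fin_cases j
        · exact (dvd_add_left (h2.mul_left _)).mp (hq 0)
        · exact (dvd_add_left (h2.mul_left _)).mp (hq 1)
      exact isUnit_of_dvd_unit h3 (Polynomial.isUnit_C.mpr (Ne.isUnit hj))
    · have h1 := aeval_coneForm a b A B (Polynomial.C (u 0)) (Polynomial.C (u 1)) Polynomial.X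
      have h2 : aeval ![Polynomial.C (u 0), Polynomial.C (u 1)] B = (0 : Polynomial ℂ) := by
        have h3 : (![Polynomial.C (u 0), Polynomial.C (u 1)] : Fin 2 → Polynomial ℂ) =
            fun i => algebraMap ℂ (Polynomial ℂ) (u i) := by
          funext i
          fin_cases i <;> rfl
        rw [h3]
        refine (aeval_algebraMap_apply (Polynomial ℂ) u B).trans ?_
        show algebraMap ℂ (Polynomial ℂ) (eval u B) = 0
        rw [hu, map_zero]
      rw [h2, hA0, map_zero, mul_zero, zero_add] at h1
      rw [hA0]
      simp only [Algebra.algebraMap_self, Polynomial.map_id]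
      exact h1
  · set A₁ := dehomogenization A with hA₁
    set B₁ := dehomogenization B with hB₁
    have hA₁0 : A₁ ≠ 0 := dehomogenization_ne_zero hA hA0
    refine ⟨![A₁ * Polynomial.X + Polynomial.C a * -B₁, A₁ + Polynomial.C b * -B₁, -B₁],
      exists_natDegree_pos hA₁0 a b, fun q hq => ?_, ?_⟩
    · have hqB : q ∣ -B₁ := hq 2
      have hqA : q ∣ A₁ := (dvd_add_left (hqB.mul_left _)).mp (hq 1)
      rw [dvd_neg] at hqB
      by_contra hunit
      have hdeg : q.degree ≠ 0 := by
        intro h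
        exact hunit (Polynomial.isUnit_iff_degree_eq_zero.mpr h)
      obtain ⟨t, ht⟩ := IsAlgClosed.exists_root q hdeg
      have hAt := ht.dvd hqA
      have hBt := ht.dvd hqB
      rw [Polynomial.IsRoot, eval_dehomogenization] at hAt hBt
      have ht0 : (![t, 1] : Fin 2 → ℂ) ≠ 0 := fun h => one_ne_zero (congrFun h 1)
      -- A common root `t` of `A₁` and `B₁` gives a linear factor of the curve. Irreducibility
      -- leaves only `m = 0`, where `A` is a constant with a zero, contradicting `A ≠ 0`.
      have hm : m = 0 := eq_zero_of_isHomogeneous_dvd hirr (coneForm_isHomogeneous hA hB)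
        (cone_isHomogeneous (linearFormAt_isHomogeneous _))
        (cone_linearFormAt_dvd_coneForm hA hB ht0 hAt hBt)
      subst hm
      rw [totalDegree_eq_zero_iff_eq_C.mp
        (Nat.le_zero.mp hA.totalDegree_le)] at hAt hA0
      rw [eval_C] at hAt
      rw [hAt, C_0] at hA0
      exact hA0 rfl
    · have h1 := aeval_coneForm a b A B (A₁ * Polynomial.X) A₁ (-B₁)
      rw [aeval_mul_X_self hA, aeval_mul_X_self hB] at h1
      simp only [Algebra.algebraMap_self, Polynomial.map_id]
      refine h1.trans ?_
      rw [← hA₁, ← hB₁]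
      ring

/-! ### Hausdorff distance for complex equations of real curves -/

theorem homogeneousComponent_map {σ R S : Type*} [CommSemiring R] [CommSemiring S] (φ : R →+* S)
    (n : ℕ) (p : MvPolynomial σ R) :
    homogeneousComponent n (map φ p) = map φ (homogeneousComponent n p) := by
  ext d
  simp only [coeff_homogeneousComponent, coeff_map]
  split_ifs <;> simp

theorem realPoints_map_ofReal (g : MvPolynomial (Fin 2) ℝ) :
    realPoints (map (algebraMap ℝ ℂ) g) = {p | eval (fun i => p i) g = 0} := by
  ext p
  show eval (fun i => ((p i : ℝ) : ℂ)) _ = 0 ↔ _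
  rw [eval_map]
  have : eval₂ (algebraMap ℝ ℂ) (fun i => algebraMap ℝ ℂ (p i)) g =
      algebraMap ℝ ℂ (eval (fun i => p i) g) := by
    rw [← eval₂_id, hom_eval₂]
    rfl
  exact (iff_of_eq (congrArg (· = 0) this)).trans (map_eq_zero (algebraMap ℝ ℂ))

theorem realPoints_C_mul {c : ℂ} (hc : c ≠ 0) (f : MvPolynomial (Fin 2) ℂ) :
    realPoints (C c * f) = realPoints f := by
  ext p
  simp [realPoints, hc]

/-- A real irreducible curve is, up to a constant, defined by a real polynomial. -/
theorem exists_map_ofReal_eq_C_inv_mul {f : MvPolynomial (Fin 2) ℂ} (hf : Irreducible f)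
    (hreal : IsReal f) {d : Fin 2 →₀ ℕ} {c : ℂ} (hc : c ≠ 0) (hd : coeff d f = c) :
    ∃ g : MvPolynomial (Fin 2) ℝ, map (algebraMap ℝ ℂ) g = C c⁻¹ * f := by
  have hc' := inv_ne_zero hc
  refine exists_map_ofReal (d := d) ?_ ?_ ?_
  · refine (irreducible_isUnit_mul ?_).mpr hf
    exact (Ne.isUnit hc').map C
  · rw [IsReal, realPoints_C_mul hc']
    exact hreal
  · rw [coeff_C_mul, hd, inv_mul_cancel₀ hc]

theorem totalDegree_eq_of_map_eq {K : Type*} [Field K] {φ : K →+* ℂ} {g : MvPolynomial (Fin 2) K}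
    {c : ℂ} (hc : c ≠ 0) {f : MvPolynomial (Fin 2) ℂ} (h : map φ g = C c * f) :
    g.totalDegree = f.totalDegree := by
  have h1 : (map φ g).totalDegree = g.totalDegree := by
    rw [totalDegree, totalDegree, support_map_of_injective _ φ.injective]
  rw [← h1, h]
  by_cases hf : f = 0
  · simp [hf]
  · rw [totalDegree_mul_of_isDomain (by simpa using hc) hf, totalDegree_C, zero_add]

/-- Dividing each equation by its own coefficient at the same leading monomial `d` makes both real
and their leading forms equal. Simplicity of the real zeros is inherited from the complex count of
points at infinity. -/
theorem finiteHausdorffDistance_of_homogeneousComponent {f g : MvPolynomial (Fin 2) ℂ} {n : ℕ}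
    (hf : Irreducible f) (hg : Irreducible g) (hfr : IsReal f) (hgr : IsReal g)
    (hhaus : IsHausdorffCurve f) (hfn : f.totalDegree = n) (hgn : g.totalDegree = n) {c : ℂ}
    (hc : c ≠ 0) (htop : homogeneousComponent n g = c • homogeneousComponent n f) :
    FiniteHausdorffDistance f g := by
  have hh0 : homogeneousComponent n f ≠ 0 := by
    rw [← hfn]
    exact homogeneousComponent_totalDegree_ne_zero hf.ne_zero
  obtain ⟨d, hd⟩ := ne_zero_iff.mp hh0
  have hdn : d.degree = n := by
    by_contra h
    exact hd ((homogeneousComponent_isHomogeneous n f).coeff_eq_zero h)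
  have hfd : coeff d f ≠ 0 := by rwa [coeff_homogeneousComponent, if_pos hdn] at hd
  have hgd : coeff d g = c * coeff d f := by
    have := congrArg (coeff d) htop
    rwa [coeff_smul, coeff_homogeneousComponent, coeff_homogeneousComponent, if_pos hdn,
      if_pos hdn, smul_eq_mul] at this
  have hgd0 : c * coeff d f ≠ 0 := mul_ne_zero hc hfd
  obtain ⟨f₀, hf₀⟩ := exists_map_ofReal_eq_C_inv_mul hf hfr hfd rfl
  obtain ⟨g₀, hg₀⟩ := exists_map_ofReal_eq_C_inv_mul hg hgr hgd0 hgd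
  have hf₀n : f₀.totalDegree = n := (totalDegree_eq_of_map_eq (inv_ne_zero hfd) hf₀).trans hfn
  have hg₀n : g₀.totalDegree = n := (totalDegree_eq_of_map_eq (inv_ne_zero hgd0) hg₀).trans hgn
  have hf₀top : map (algebraMap ℝ ℂ) (homogeneousComponent n f₀) =
      C (coeff d f)⁻¹ * homogeneousComponent n f := by
    rw [← homogeneousComponent_map, hf₀, homogeneousComponent_C_mul]
  have htop₀ : homogeneousComponent n g₀ = homogeneousComponent n f₀ := by
    refine map_injective _ (algebraMap ℝ ℂ).injective ?_
    rw [hf₀top, ← homogeneousComponent_map, hg₀, homogeneousComponent_C_mul, htop, smul_eq_C_mul,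
      ← mul_assoc, ← C_mul, mul_inv, mul_comm c⁻¹, mul_assoc _ c⁻¹, inv_mul_cancel₀ hc, mul_one]
  have hsimple : ∀ u : Fin 2 → ℝ, u ≠ 0 → eval u (homogeneousComponent n f₀) = 0 →
      ∃ w : Fin 2 → ℝ,
        deriv (fun t : ℝ => eval (fun i => u i + t * w i) (homogeneousComponent n f₀)) 0 ≠ 0 := by
    intro u hu0 hu
    have hev : ∀ w : Fin 2 → ℝ, eval (fun i => algebraMap ℝ ℂ (w i))
        (map (algebraMap ℝ ℂ) (homogeneousComponent n f₀)) =
        algebraMap ℝ ℂ (eval w (homogeneousComponent n f₀)) := by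
      intro w
      rw [eval_map, ← eval₂_id, hom_eval₂]
      rfl
    have hne : homogeneousComponent n f₀ ≠ 0 := by
      rw [← hf₀n]
      refine homogeneousComponent_totalDegree_ne_zero ?_
      rintro rfl
      rw [map_zero] at hf₀
      exact mul_ne_zero (by simpa using hfd) hf.ne_zero hf₀.symm
    obtain ⟨w, hw⟩ := exists_eval_ne_zero hne
    refine ⟨w, ?_⟩
    have h1 := eval_derivative_restrictLine_ne_zero
      ((homogeneousComponent_isHomogeneous n f₀).map (algebraMap ℝ ℂ))
      (S := pointsAtInfinity f) (by rw [hhaus, hfn])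
      (fun Q hQ => ⟨hQ.1, by
        have h2 := hQ.2
        rw [hfn] at h2
        rw [hf₀top, map_mul, h2, mul_zero]⟩)
      (u := fun i => algebraMap ℝ ℂ (u i)) (w := fun i => algebraMap ℝ ℂ (w i))
      (fun h => hu0 (by
        funext i
        exact Complex.ofReal_injective (by simpa using congrFun h i)))
      (by rw [hev, hu, map_zero])
      (by rw [hev]; exact (map_ne_zero _).mpr hw)
    rw [restrictLine_map, Polynomial.derivative_map] at h1
    have h3 : (fun t : ℝ => eval (fun i => u i + t * w i) (homogeneousComponent n f₀)) =
        fun t => (restrictLine (homogeneousComponent n f₀) u w).eval t := by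
      funext t
      rw [eval_restrictLine]
    rw [h3, Polynomial.deriv]
    intro h4
    apply h1
    have h5 := Polynomial.eval_map_apply (algebraMap ℝ ℂ) (p := Polynomial.derivative
      (restrictLine (homogeneousComponent n f₀) u w)) 0
    rw [map_zero, h4, map_zero] at h5
    exact h5
  have hfz : realPoints f = {p | eval (fun i => p i) f₀ = 0} := by
    rw [← realPoints_map_ofReal, hf₀, realPoints_C_mul (inv_ne_zero hfd)]
  have hgz : realPoints g = {p | eval (fun i => p i) g₀ = 0} := by
    rw [← realPoints_map_ofReal, hg₀, realPoints_C_mul (inv_ne_zero hgd0)]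
  have hfne := hfr.nonempty
  have hgne := hgr.nonempty
  rw [hfz] at hfne
  rw [hgz] at hgne
  obtain ⟨M, hM⟩ := exists_forall_exists_dist_le_of_homogeneousComponent_eq hf₀n.le hg₀n.le
    htop₀.symm (by rwa [htop₀]) hgne
  obtain ⟨M', hM'⟩ := exists_forall_exists_dist_le_of_homogeneousComponent_eq hg₀n.le hf₀n.le
    htop₀ hsimple hfne
  rw [FiniteHausdorffDistance, hfz, hgz]
  refine lt_of_le_of_lt (Metric.hausdorffEDist_le_of_mem_edist (r := ENNReal.ofReal (max M M'))
    (fun p hp => ?_) (fun p hp => ?_)) ENNReal.ofReal_lt_top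
  · obtain ⟨q, hq, hpq⟩ := hM p hp
    exact ⟨q, hq, by rw [edist_dist]; exact ENNReal.ofReal_le_ofReal (le_max_of_le_left hpq)⟩
  · obtain ⟨q, hq, hpq⟩ := hM' p hp
    exact ⟨q, hq, by rw [edist_dist]; exact ENNReal.ofReal_le_ofReal (le_max_of_le_right hpq)⟩

theorem finiteHausdorffDistance_coneForm {f A : MvPolynomial (Fin 2) ℂ} {m : ℕ} {a b c : ℂ}
    (hf : Irreducible f) (hfr : IsReal f) (hhaus : IsHausdorffCurve f)
    (hdeg : f.totalDegree = m + 1) (hA : A.IsHomogeneous m)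
    (hirr : Irreducible (coneForm a b A (c • homogeneousComponent (m + 1) f)))
    (hreal : IsReal (affinePart (coneForm a b A (c • homogeneousComponent (m + 1) f)))) :
    FiniteHausdorffDistance f
      (affinePart (coneForm a b A (c • homogeneousComponent (m + 1) f))) := by
  -- For `c = 0` the form is divisible by `X 2`; being irreducible it would be the line at infinity,
  -- which has no affine points.
  have hc : c ≠ 0 := by
    rintro rfl
    rw [zero_smul, coneForm, map_zero, add_zero] at hirr hreal
    have hX : ¬ IsUnit (X 2 : MvPolynomial (Fin 3) ℂ) := by
      intro h
      obtain ⟨r, -, hr⟩ := isUnit_iff_eq_C_of_isReduced.mp h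
      have := congrArg totalDegree hr
      simp at this
    have hu := (hirr.isUnit_or_isUnit rfl).resolve_left hX
    have hu' : IsUnit (affinePart (X 2 * cone a b A)) := by
      rw [affinePart, map_mul, aeval_X]
      exact IsUnit.mul (by simp) (hu.map _)
    obtain ⟨p, hp⟩ := hreal.nonempty
    have h1 := hu'.map (eval fun i => (p i : ℂ))
    rw [show eval (fun i => (p i : ℂ)) _ = 0 from hp] at h1
    exact not_isUnit_zero h1
  have hB : (c • homogeneousComponent (m + 1) f).IsHomogeneous (m + 1) := by
    rw [smul_eq_C_mul]
    exact (homogeneousComponent_isHomogeneous (m + 1) f).C_mul c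
  have hF := coneForm_isHomogeneous (a := a) (b := b) hA hB
  have htop := homogeneousComponent_affinePart_coneForm (a := a) (b := b) hA hB
  have hgn : (affinePart (coneForm a b A (c • homogeneousComponent (m + 1) f))).totalDegree =
      m + 1 := by
    refine le_antisymm (totalDegree_affinePart_le hF) ?_
    by_contra! h
    rw [homogeneousComponent_eq_zero _ _ h] at htop
    have hh0 : homogeneousComponent (m + 1) f ≠ 0 := by
      rw [← hdeg]
      exact homogeneousComponent_totalDegree_ne_zero hf.ne_zero
    exact smul_ne_zero hc hh0 htop.symm
  have hgirr := irreducible_affinePart (by rwa [hgn]) hirr (by omega)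
  exact finiteHausdorffDistance_of_homogeneousComponent hf hgirr hfr hreal hhaus hdeg hgn hc htop

/-! ### An explicit infinite family over the field of definition -/

/-- The form `c (x - t₀ y) ^ m`. -/
def powForm {k : Type*} [Field k] (c t₀ : k) (m : ℕ) : MvPolynomial (Fin 2) k :=
  C c * (X 0 - C t₀ * X 1) ^ m

section PowForm

variable {k : Type*} [Field k] (c t₀ : k) (m : ℕ)

theorem powForm_isHomogeneous : (powForm c t₀ m).IsHomogeneous m := by
  have h := (((isHomogeneous_X k (0 : Fin 2)).sub (isHomogeneous_C_mul_X t₀ 1)).pow m).C_mul c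
  rwa [one_mul] at h

theorem eval_powForm (t : k) : eval ![t, 1] (powForm c t₀ m) = c * (t - t₀) ^ m := by
  simp [powForm]

theorem dehomogenization_powForm :
    dehomogenization (powForm c t₀ m) =
      Polynomial.C c * (Polynomial.X - Polynomial.C t₀) ^ m := by
  simp [dehomogenization, powForm, Polynomial.algebraMap_eq]

end PowForm

theorem dehomogenization_map {k l : Type*} [Field k] [Field l] (φ : k →+* l)
    (A : MvPolynomial (Fin 2) k) : dehomogenization (map φ A) = (dehomogenization A).map φ := by
  induction A using MvPolynomial.induction_on with
  | C a => simp [dehomogenization, Polynomial.algebraMap_eq]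
  | add p q hp hq => simp only [dehomogenization, map_add, Polynomial.map_add] at *; rw [hp, hq]
  | mul_X p i hp =>
    simp only [dehomogenization, map_mul, Polynomial.map_mul] at *
    rw [hp]
    fin_cases i <;> simp

theorem cone_zero_zero (A : MvPolynomial (Fin 2) ℂ) : cone 0 0 A = rename Fin.castSucc A := by
  rw [cone, rename_eq_aeval]
  congr 2
  funext i
  fin_cases i <;> simp

theorem two_notMem_vars_cone (A : MvPolynomial (Fin 2) ℂ) : (2 : Fin 3) ∉ (cone 0 0 A).vars := by
  classical
  rw [cone_zero_zero]
  intro h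
  obtain ⟨i, -, hi⟩ := Finset.mem_image.mp (vars_rename _ _ h)
  exact absurd hi (Fin.castSucc_lt_last i).ne

theorem irreducible_of_isHomogeneous_one {σ k : Type*} [Field k] {p : MvPolynomial σ k}
    (hp : p.IsHomogeneous 1) (hp0 : p ≠ 0) : Irreducible p := by
  refine irreducible_of_totalDegree_eq_one (hp.totalDegree hp0) fun x hx => ?_
  obtain ⟨d, hd⟩ := ne_zero_iff.mp hp0
  exact Ne.isUnit (ne_zero_of_dvd_ne_zero hd (hx d))

/-- The form has degree one in `X 2`, so it suffices that its two coefficients are coprime. The only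
prime factor the first can have is the line `x = t₀ y`, on which the second is not identically zero.
-/
theorem irreducible_coneForm_powForm {c t₀ : ℂ} {m : ℕ} (hc : c ≠ 0) {B : MvPolynomial (Fin 2) ℂ}
    (hB : eval ![t₀, 1] B ≠ 0) : Irreducible (coneForm 0 0 (powForm c t₀ m) B) := by
  set L : MvPolynomial (Fin 2) ℂ := X 0 - C t₀ * X 1 with hL
  have hL1 : L.IsHomogeneous 1 := (isHomogeneous_X _ _).sub (isHomogeneous_C_mul_X _ _)
  have hL0 : cone 0 0 L ≠ 0 := by
    intro h
    have h1 := congrArg (eval ![1, 0, 0]) h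
    simp [hL, cone] at h1
  have hLirr : Irreducible (cone 0 0 L) :=
    irreducible_of_isHomogeneous_one (cone_isHomogeneous hL1) hL0
  have hcu : IsUnit (C c : MvPolynomial (Fin 3) ℂ) := (Ne.isUnit hc).map C
  have hA : cone 0 0 (powForm c t₀ m) = C c * cone 0 0 L ^ m := by
    rw [powForm, map_mul, map_pow, cone, aeval_C, algebraMap_eq]
  rw [coneForm, mul_comm]
  refine irreducible_mul_X_add _ _ _ ?_ (two_notMem_vars_cone _) (two_notMem_vars_cone _) ?_
  · rw [hA]
    exact mul_ne_zero hcu.ne_zero (pow_ne_zero _ hL0)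
  · rw [hA, isRelPrime_mul_unit_left_left hcu]
    refine IsRelPrime.pow_left ?_
    rw [hLirr.isRelPrime_iff_not_dvd]
    rintro ⟨q, hq⟩
    apply hB
    have h1 := congrArg (eval ![t₀, 1, 0]) hq
    have h2 : ∀ A, eval ![t₀, 1, 0] (cone 0 0 A) = eval ![t₀, 1] A := by
      intro A
      have := eval_coneForm 0 0 0 A ![t₀, 1, 0]
      simpa [coneForm] using this
    rw [map_mul, h2, h2] at h1
    simpa [hL] using h1

theorem eval_affinePart_coneForm {A B : MvPolynomial (Fin 2) ℂ} {m : ℕ} (hA : A.IsHomogeneous m)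
    (hB : B.IsHomogeneous (m + 1)) (s t : ℂ) :
    eval ![s * t, s] (affinePart (coneForm 0 0 A B)) =
      s ^ m * (eval ![t, 1] A + s * eval ![t, 1] B) := by
  have h : (![s * t, s] : Fin 2 → ℂ) = fun i => s * ![t, 1] i := by
    funext i
    fin_cases i <;> simp
  have h2 : eval ![s * t, s] (affinePart (coneForm 0 0 A B)) =
      eval ![s * t, s] A + eval ![s * t, s] B := by
    rw [eval_affinePart, eval_coneForm]
    simp
  rw [h2, h, eval_mul_of_isHomogeneous hA, eval_mul_of_isHomogeneous hB]
  ring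

theorem infinite_setOf_ne_and_eval_ne_zero {k : Type*} [Field k] [Infinite k] (t₀ : k)
    {p : Polynomial k} (hp : p ≠ 0) : {t : k | t ≠ t₀ ∧ p.eval t ≠ 0}.Infinite := by
  have h : (insert t₀ {t | p.IsRoot t}).Finite :=
    (Polynomial.finite_setOfPred_isRoot hp).insert t₀
  refine h.infinite_compl.mono fun t ht => ?_
  rw [Set.mem_compl_iff, Set.mem_insert_iff, not_or] at ht
  exact ht

theorem isReal_affinePart_coneForm_powForm {c t₀ : ℝ} (hc : c ≠ 0) {m : ℕ}
    {B : MvPolynomial (Fin 2) ℝ} (hB : B.IsHomogeneous (m + 1)) (hB0 : B ≠ 0) :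
    IsReal (affinePart (coneForm 0 0 (powForm (c : ℂ) t₀ m) (map (algebraMap ℝ ℂ) B))) := by
  -- The `y`-coordinate of the residual intersection with the line `x = t y`. Excluding `t = t₀`
  -- keeps it nonzero, so that `t` can be recovered from the point.
  let s : ℝ → ℝ := fun t => -(c * (t - t₀) ^ m) / eval ![t, 1] B
  have hinf := infinite_setOf_ne_and_eval_ne_zero t₀ (dehomogenization_ne_zero hB hB0)
  have hev : ∀ t : ℝ, eval ![(t : ℂ), 1] (map (algebraMap ℝ ℂ) B) =
      ((eval ![t, 1] B : ℝ) : ℂ) := by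
    intro t
    rw [← eval_dehomogenization, dehomogenization_map, ← eval_dehomogenization]
    exact Polynomial.eval_map_apply (algebraMap ℝ ℂ) t
  refine Set.infinite_of_injOn_mapsTo
    (f := fun t => (WithLp.toLp 2 ![s t * t, s t] : EuclideanSpace ℝ (Fin 2))) ?_ ?_ hinf
  · rintro t ⟨ht, ht'⟩ t' - h
    rw [eval_dehomogenization] at ht'
    have h1 : s t = s t' := congrFun (congrArg WithLp.ofLp h) 1
    have h2 : s t * t = s t' * t' := congrFun (congrArg WithLp.ofLp h) 0
    have hs : s t ≠ 0 :=
      div_ne_zero (neg_ne_zero.mpr (mul_ne_zero hc (pow_ne_zero _ (sub_ne_zero.mpr ht)))) ht'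
    rw [← h1] at h2
    exact mul_left_cancel₀ hs h2
  · rintro t ⟨ht, ht'⟩
    rw [eval_dehomogenization] at ht'
    have h1 := eval_affinePart_coneForm (powForm_isHomogeneous (c : ℂ) (t₀ : ℂ) m)
      (hB.map (algebraMap ℝ ℂ)) (s t) t
    have h2 : (fun i => (((WithLp.toLp 2 ![s t * t, s t] : EuclideanSpace ℝ (Fin 2)) i : ℝ) : ℂ)) =
        ![(s t : ℂ) * t, (s t : ℂ)] := by
      funext i
      fin_cases i <;> simp
    show eval _ _ = 0
    rw [h2, h1, eval_powForm, hev]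
    have h3 : c * (t - t₀) ^ m + s t * eval ![t, 1] B = 0 := by
      simp only [s]
      rw [div_mul_cancel₀ _ ht']
      ring
    have h4 : (c : ℂ) * ((t : ℂ) - t₀) ^ m + (s t : ℂ) * ((eval ![t, 1] B : ℝ) : ℂ) = 0 := by
      exact_mod_cast h3
    rw [h4, mul_zero]

/-- On a general line through the origin the unique other point of the curve determines `c`, so even
the point sets differ. -/
theorem affineCurve_coneForm_powForm_injective {t₀ : ℂ} {m : ℕ} {B : MvPolynomial (Fin 2) ℂ}
    (hB : B.IsHomogeneous (m + 1)) (hB0 : B ≠ 0) {c c' : ℂ} (hc : c ≠ 0)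
    (h : affineCurve (affinePart (coneForm 0 0 (powForm c t₀ m) B)) =
      affineCurve (affinePart (coneForm 0 0 (powForm c' t₀ m) B))) : c = c' := by
  obtain ⟨t, ht, ht'⟩ :=
    (infinite_setOf_ne_and_eval_ne_zero t₀ (dehomogenization_ne_zero hB hB0)).nonempty
  rw [eval_dehomogenization] at ht'
  have hp : (t - t₀) ^ m ≠ 0 := pow_ne_zero _ (sub_ne_zero.mpr ht)
  set s : ℂ := -(c * (t - t₀) ^ m) / eval ![t, 1] B with hs
  have hs0 : s ≠ 0 := div_ne_zero (neg_ne_zero.mpr (mul_ne_zero hc hp)) ht'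
  have hsB : s * eval ![t, 1] B = -(c * (t - t₀) ^ m) := div_mul_cancel₀ _ ht'
  have hmem : ![s * t, s] ∈ affineCurve (affinePart (coneForm 0 0 (powForm c t₀ m) B)) := by
    show eval _ _ = 0
    rw [eval_affinePart_coneForm (powForm_isHomogeneous _ _ _) hB, eval_powForm, hsB]
    ring
  rw [h] at hmem
  have h1 : eval ![s * t, s] (affinePart (coneForm 0 0 (powForm c' t₀ m) B)) = 0 := hmem
  rw [eval_affinePart_coneForm (powForm_isHomogeneous _ _ _) hB, eval_powForm, hsB] at h1
  have h2 := (mul_eq_zero.mp h1).resolve_left (pow_ne_zero _ hs0)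
  exact mul_right_cancel₀ hp (by linear_combination -h2)

theorem parametrizableOver_coneForm_powForm {k : Type} [Field k] [Algebra k ℂ] {c t₀ : k}
    (hc : c ≠ 0) {m : ℕ} {B : MvPolynomial (Fin 2) k} (hB : B.IsHomogeneous (m + 1))
    (hBt : eval ![t₀, 1] B ≠ 0) :
    ParametrizableOver k (coneForm 0 0 (powForm (algebraMap k ℂ c) (algebraMap k ℂ t₀) m)
      (map (algebraMap k ℂ) B)) := by
  set A₁ : Polynomial k := Polynomial.C c * (Polynomial.X - Polynomial.C t₀) ^ m with hA₁
  set B₁ : Polynomial k := dehomogenization B with hB₁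
  have hA₁0 : A₁ ≠ 0 := mul_ne_zero (by simpa using hc) (pow_ne_zero _ (Polynomial.X_sub_C_ne_zero _))
  refine ⟨![A₁ * Polynomial.X, A₁, -B₁], by simpa using exists_natDegree_pos hA₁0 (q := -B₁) 0 0,
    fun q hq => ?_, ?_⟩
  · have hqA : q ∣ A₁ := hq 1
    have hqB : q ∣ B₁ := (dvd_neg.mp (hq 2))
    rw [hA₁, ((Ne.isUnit hc).map Polynomial.C).dvd_mul_left] at hqA
    refine IsCoprime.isUnit_of_dvd' (IsCoprime.pow_left ?_) hqA hqB
    rw [(Polynomial.irreducible_X_sub_C t₀).coprime_iff_not_dvd, Polynomial.dvd_iff_isRoot,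
      Polynomial.IsRoot, eval_dehomogenization]
    exact hBt
  · have h1 := aeval_coneForm 0 0 (powForm (algebraMap k ℂ c) (algebraMap k ℂ t₀) m)
      (map (algebraMap k ℂ) B) (A₁.map (algebraMap k ℂ) * Polynomial.X)
      (A₁.map (algebraMap k ℂ)) (-B₁.map (algebraMap k ℂ))
    rw [aeval_mul_X_self (powForm_isHomogeneous _ _ _), aeval_mul_X_self (hB.map _),
      dehomogenization_powForm, dehomogenization_map, ← hB₁] at h1
    have h2 : A₁.map (algebraMap k ℂ) = Polynomial.C (algebraMap k ℂ c) *
        (Polynomial.X - Polynomial.C (algebraMap k ℂ t₀)) ^ m := by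
      simp [hA₁]
    rw [← h2] at h1
    have h3 : (fun i => (![A₁ * Polynomial.X, A₁, -B₁] i).map (algebraMap k ℂ)) =
        ![A₁.map (algebraMap k ℂ) * Polynomial.X + algebraMap ℂ (Polynomial ℂ) 0 *
          -B₁.map (algebraMap k ℂ), A₁.map (algebraMap k ℂ) +
          algebraMap ℂ (Polynomial ℂ) 0 * -B₁.map (algebraMap k ℂ), -B₁.map (algebraMap k ℂ)] := by
      funext i
      fin_cases i <;> simp
    rw [h3]
    refine h1.trans ?_
    ring

theorem exists_zero_of_isHausdorffCurve {f : MvPolynomial (Fin 2) ℂ} {m : ℕ}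
    (hhaus : IsHausdorffCurve f) (hdeg : f.totalDegree = m + 1) :
    ∃ u : Fin 2 → ℂ, u ≠ 0 ∧ eval u (homogeneousComponent (m + 1) f) = 0 := by
  have hne : (pointsAtInfinity f).Nonempty := by
    rw [← Set.encard_ne_zero, hhaus, hdeg]
    exact_mod_cast Nat.succ_ne_zero m
  obtain ⟨Q, hQ2, hQ⟩ := hne
  rw [hdeg] at hQ
  refine ⟨_, fun h => Q.rep_nonzero ?_, hQ⟩
  funext i
  fin_cases i
  · exact congrFun h 0
  · exact congrFun h 1
  · exact hQ2

theorem infinite_monomial_curves {K : Subfield ℂ} {f : MvPolynomial (Fin 2) ℂ} {m : ℕ}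
    (hirr : Irreducible f) (hreal : IsReal f) (hdef : IsDefinableOver K f)
    (hhaus : IsHausdorffCurve f) (hdeg : f.totalDegree = m + 1) :
    {Z : Set (Fin 2 → ℂ) | ∃ F : MvPolynomial (Fin 3) ℂ,
        Z = affineCurve (affinePart F) ∧ IsReal (affinePart F) ∧ IsMonomialCurve F ∧
        IsRational F ∧ ParametrizableOver K F ∧
        FiniteHausdorffDistance f (affinePart F)}.Infinite := by
  have hh0 : homogeneousComponent (m + 1) f ≠ 0 := by
    rw [← hdeg]
    exact homogeneousComponent_totalDegree_ne_zero hirr.ne_zero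
  obtain ⟨d, hd⟩ := ne_zero_iff.mp hh0
  have hfd : coeff d f ≠ 0 := by
    rw [coeff_homogeneousComponent] at hd
    split_ifs at hd
    · exact hd
    · exact absurd rfl hd
  obtain ⟨fR, hfR⟩ := exists_map_ofReal_eq_C_inv_mul hirr hreal hfd rfl
  obtain ⟨g, c₀, hc₀, hg⟩ := hdef
  have hgd : algebraMap K ℂ (coeff d g) = c₀ * coeff d f := by
    rw [← coeff_map, hg, coeff_C_mul]
  -- Normalizing one leading coefficient to 1 makes `B` descend both to `ℝ`, needed for real points,
  -- and to `K`, needed for the parametrization.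
  set B : MvPolynomial (Fin 2) ℂ := (coeff d f)⁻¹ • homogeneousComponent (m + 1) f with hB
  set BR := homogeneousComponent (m + 1) fR with hBR
  set BK := homogeneousComponent (m + 1) (C (coeff d g)⁻¹ * g) with hBK
  have hBn : B.IsHomogeneous (m + 1) := by
    rw [hB, smul_eq_C_mul]
    exact (homogeneousComponent_isHomogeneous _ _).C_mul _
  have hmapR : map (algebraMap ℝ ℂ) BR = B := by
    rw [hBR, ← homogeneousComponent_map, hfR, homogeneousComponent_C_mul, hB, smul_eq_C_mul]
  have hmapK : map (algebraMap K ℂ) BK = B := by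
    rw [hBK, ← homogeneousComponent_map, map_mul, map_C, map_inv₀, hgd, hg, ← mul_assoc, ← C_mul,
      homogeneousComponent_C_mul, hB, smul_eq_C_mul, mul_inv, mul_right_comm, inv_mul_cancel₀ hc₀,
      one_mul]
  have hB0 : B ≠ 0 := smul_ne_zero (inv_ne_zero hfd) hh0
  have hBR0 : BR ≠ 0 := by
    intro h
    rw [h, map_zero] at hmapR
    exact hB0 hmapR.symm
  obtain ⟨t₀, ht₀⟩ : ∃ t₀ : ℕ, eval ![(t₀ : ℂ), 1] B ≠ 0 := by
    by_contra! h
    refine dehomogenization_ne_zero hBn hB0 (Polynomial.eq_zero_of_infinite_isRoot _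
      ((Set.infinite_range_of_injective (Nat.cast_injective (R := ℂ))).mono ?_))
    rintro _ ⟨t, rfl⟩
    show Polynomial.eval _ _ = 0
    rw [eval_dehomogenization, h]
  have hc : ∀ j : ℕ, ((j + 1 : ℕ) : ℂ) ≠ 0 := fun j => Nat.cast_ne_zero.mpr (Nat.succ_ne_zero j)
  obtain ⟨u, hu0, hu⟩ := exists_zero_of_isHausdorffCurve hhaus hdeg
  have huB : eval u B = 0 := by rw [hB, smul_eval, hu, mul_zero]
  -- The scalar is `j + 1` rather than `j` so that it never vanishes.
  refine Set.infinite_of_injective_forall_mem (f := fun j : ℕ =>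
    affineCurve (affinePart (coneForm 0 0 (powForm ((j + 1 : ℕ) : ℂ) (t₀ : ℂ) m) B))) ?_ ?_
  · intro j j' h
    have := affineCurve_coneForm_powForm_injective hBn hB0 (hc j) h
    simpa using this
  · intro j
    have hAn := powForm_isHomogeneous ((j + 1 : ℕ) : ℂ) (t₀ : ℂ) m
    have hF : Irreducible (coneForm 0 0 (powForm ((j + 1 : ℕ) : ℂ) (t₀ : ℂ) m) B) :=
      irreducible_coneForm_powForm (hc j) ht₀
    have hFr : IsReal (affinePart (coneForm 0 0 (powForm ((j + 1 : ℕ) : ℂ) (t₀ : ℂ) m) B)) := by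
      have := isReal_affinePart_coneForm_powForm (c := ((j + 1 : ℕ) : ℝ)) (t₀ := (t₀ : ℝ)) (m := m)
        (Nat.cast_ne_zero.mpr (Nat.succ_ne_zero j)) (homogeneousComponent_isHomogeneous _ fR) hBR0
      rwa [← hBR, hmapR, Complex.ofReal_natCast, Complex.ofReal_natCast] at this
    refine ⟨_, rfl, hFr, isMonomialCurve_coneForm hAn hBn hu0 huB hF,
      isRational_coneForm hAn hBn hu0 huB hF, ?_,
      finiteHausdorffDistance_coneForm hirr hreal hhaus hdeg hAn hF hFr⟩
    have hBt : eval ![(t₀ : K), 1] BK ≠ 0 := by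
      intro h
      apply ht₀
      rw [← hmapK, ← eval_dehomogenization, dehomogenization_map, ← map_natCast (algebraMap K ℂ),
        Polynomial.eval_map_apply, eval_dehomogenization, h, map_zero]
    have := parametrizableOver_coneForm_powForm (c := ((j + 1 : ℕ) : K)) (t₀ := (t₀ : K)) (m := m)
      (Nat.cast_ne_zero.mpr (Nat.succ_ne_zero j)) (homogeneousComponent_isHomogeneous _ _) hBt
    rwa [← hBK, hmapK, map_natCast, map_natCast] at this

end HausdorffCurves

end

theorem corollary5p5 (K : Subfield ℂ) (n : ℕ) (f : MvPolynomial (Fin 2) ℂ)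
    (hirr : Irreducible f) (hreal : HausdorffCurves.IsReal f)
    (hdef : HausdorffCurves.IsDefinableOver K f)
    (hhaus : HausdorffCurves.IsHausdorffCurve f) (hdeg : f.totalDegree = n) :
    {Z : Set (Fin 2 → ℂ) | ∃ F : MvPolynomial (Fin 3) ℂ,
        Z = HausdorffCurves.affineCurve (HausdorffCurves.affinePart F) ∧
        HausdorffCurves.IsReal (HausdorffCurves.affinePart F) ∧
        HausdorffCurves.IsMonomialCurve F ∧
        HausdorffCurves.IsRational F ∧
        HausdorffCurves.ParametrizableOver K F ∧
        HausdorffCurves.FiniteHausdorffDistance f (HausdorffCurves.affinePart F)}.Infinite ∧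
    ∀ a b : ℂ, HausdorffCurves.IsAdmissible f a b →
      HausdorffCurves.projDim (HausdorffCurves.linearSystem n
        (HausdorffCurves.hausdorffDivisor f +
          Finsupp.single (HausdorffCurves.affinePoint a b) (n - 1))) = n ∧
      ∀ F ∈ HausdorffCurves.linearSystem n
          (HausdorffCurves.hausdorffDivisor f +
            Finsupp.single (HausdorffCurves.affinePoint a b) (n - 1)),
        Irreducible F →
          HausdorffCurves.IsMonomialCurve F ∧
          HausdorffCurves.IsRational F ∧
          (HausdorffCurves.IsReal (HausdorffCurves.affinePart F) →
            HausdorffCurves.FiniteHausdorffDistance f (HausdorffCurves.affinePart F)) := by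
  obtain _ | m := n
  -- Degree zero would make `f` a constant, which is not irreducible.
  · exfalso
    rw [totalDegree_eq_zero_iff_eq_C] at hdeg
    rw [hdeg] at hirr
    by_cases h : coeff 0 f = 0
    · rw [h, C_0] at hirr
      exact hirr.ne_zero rfl
    · exact hirr.not_isUnit ((Ne.isUnit h).map C)
  refine ⟨HausdorffCurves.infinite_monomial_curves hirr hreal hdef hhaus hdeg, fun a b _ => ?_⟩
  rw [Nat.add_sub_cancel]
  refine ⟨HausdorffCurves.projDim_linearSystem hdeg hhaus a b, fun F hF hFirr => ?_⟩
  obtain ⟨A, c, hA, rfl⟩ :=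
    (HausdorffCurves.mem_linearSystem_iff_exists_coneForm hdeg hhaus).mp hF
  obtain ⟨u, hu0, hu⟩ := HausdorffCurves.exists_zero_of_isHausdorffCurve hhaus hdeg
  have hB : (c • homogeneousComponent (m + 1) f).IsHomogeneous (m + 1) := by
    rw [smul_eq_C_mul]
    exact (homogeneousComponent_isHomogeneous (m + 1) f).C_mul c
  have huB : eval u (c • homogeneousComponent (m + 1) f) = 0 := by rw [smul_eval, hu, mul_zero]
  exact ⟨HausdorffCurves.isMonomialCurve_coneForm hA hB hu0 huB hFirr,
    HausdorffCurves.isRational_coneForm hA hB hu0 huB hFirr,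
    HausdorffCurves.finiteHausdorffDistance_coneForm hirr hreal hhaus hdeg hA hFirr⟩
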